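/- Let $\mathcal P$ be the surface of the unit cube, with faces $F_1,\dots,F_6$ labelled so that $F_1$ and $F_6$ are opposite and, seen from outside with $F_1$ in front, $F_2,F_4,F_5,F_3$ are respectively below, to the right of, above and to the left of $F_1$. *Definitions.* A **net** of the cube is a non-overlapping unfolding of its surface into a plane, obtained by cutting edges so that the uncut edges form a spanning tree of the face adjacency graph (the dual graph of the net). A **landscape** is the union of the faces of a path with at least two vertices in the dual graph of some net; it is written as the sequence of its faces from an origin face to a destination face, and a **sublandscape** of it is a landscape formed by consecutive faces of that sequence. For a landscape $L$ and points $p,q$ of $L$, $|T_L(p,q)|$ is the length of the straight segment joining $p$ and $q$ in the planar unfolding of $L$ if this segment is contained in the unfolding of $L$, and $\infty$ otherwise (if a point has several copies in the unfolding, the least value is taken). The **surface distance** $d(p,q)$ is the infimum of the lengths of the paths from $p$ to $q$ on $\mathcal P$. Points $p,q\in L$ **witness the validity** of $L$ if $|T_L(p,q)|=d(p,q)$ and no other landscape $K$ with $p,q\in K$ and $|T_K(p,q)|=|T_L(p,q)|$ is a sublandscape of $L$; $L$ is **valid** if such points exist. For adjacent faces $F,G$, $(F,G,x,y)$ denotes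 the point of $F$ with coordinates $(x,y)\in[0,1]^2$ when $F$, seen from outside, is placed so that its common edge with $G$ is the bottom edge from $(0,0)$ to $(1,0)$. A **labelling** is a permutation $(n_1,\dots,n_6)$ of $(1,\dots,6)$ such that $F_{n_1}$ and $F_{n_6}$ are opposite and $F_{n_2},F_{n_3},F_{n_4},F_{n_5}$ occur around $F_{n_1}$ in the same counter-clockwise order as $F_2,F_3,F_4,F_5$ around $F_1$. Given a labelling, write $[a\,b\,\cdots]$ for the sequence of faces $F_{n_a},F_{n_b},\dots$, and put $$L_1=[1\,2],\quad L_2=[1\,3\,2],\quad L_3=[1\,4\,2],$$ $$L_4=[1\,2\,6],\quad L_5=[1\,3\,6],\quad L_6=[1\,4\,6],\quad L_7=[1\,5\,6],$$ $$L_8=[1\,2\,3\,6],\quad L_9=[1\,3\,5\,6],\quad L_{10}=[1\,5\,4\,6],\quad L_{11}=[1\,4\,2\,6],$$ $$L_{12}=[1\,2\,4\,6],\quad L_{13}=[1\,3\,2\,6],\quad L_{14}=[1\,5\,3\,6],\quad L_{15}=[1\,4\,5\,6].$$ **Corollary (the cube has 15 valid landscapes).** A sequence of faces of the cube is a valid landscape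 if and only if it is one of $L_1,\dots,L_{15}$ for some labelling. Moreover, for every labelling: 1. $L_1,\dots,L_{15}$ are pairwise distinct; the valid landscapes from $F_{n_1}$ to the adjacent face $F_{n_2}$ are exactly $L_1,L_2,L_3$, and the valid landscapes from $F_{n_1}$ to the opposite face $F_{n_6}$ are exactly $L_4,\dots,L_{15}$. 2. The validity of $L_1,\dots,L_{15}$ is witnessed by the following pairs of points, whose surface distance is in particular attained in the respective landscape: - $L_1$: $(F_{n_1},F_{n_2},\tfrac12,\tfrac15)$ and $(F_{n_2},F_{n_1},\tfrac12,\tfrac15)$; - $L_2$: $(F_{n_1},F_{n_2},\tfrac1{10},\tfrac9{10})$ and $(F_{n_2},F_{n_1},\tfrac9{10},\tfrac9{10})$; - $L_3$: $(F_{n_1},F_{n_2},\tfrac9{10},\tfrac9{10})$ and $(F_{n_2},F_{n_1},\tfrac1{10},\tfrac9{10})$; - $L_4,L_5,L_6,L_7$: $(F_{n_1},F_{n_i},\tfrac12,\tfrac15)$ and $(F_{n_6},F_{n_i},\tfrac12,\tfrac15)$ with $i=2,3,4,5$ respectively; - $L_8,L_9,L_{10},L_{11}$: $(F_{n_1},F_{n_i},\tfrac12,\tfrac1{10})$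 and $(F_{n_6},F_{n_i},\tfrac9{10},\tfrac12)$ with $i=2,3,5,4$ respectively; - $L_{12},L_{13},L_{14},L_{15}$: $(F_{n_1},F_{n_i},\tfrac12,\tfrac1{10})$ and $(F_{n_6},F_{n_i},\tfrac1{10},\tfrac12)$ with $i=2,3,5,4$ respectively. -/

import Mathlib

namespace CubeLandscape

/-- Euclidean three-space. -/
abbrev E3 : Type := EuclideanSpace ℝ (Fin 3)

/-- The six faces of the cube, in the fixed labelling in which, looking at `F1` from outside,
`F2` is below, `F3` to the left, `F4` to the right and `F5` above, while `F6` is opposite. -/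
inductive Face : Type
  | F1 | F2 | F3 | F4 | F5 | F6

open Face

/-- Integer coordinates of the outward unit normal of a face. -/
def normalZ : Face → Fin 3 → ℤ
  | F1 => ![0, 0, 1]
  | F2 => ![0, -1, 0]
  | F3 => ![-1, 0, 0]
  | F4 => ![1, 0, 0]
  | F5 => ![0, 1, 0]
  | F6 => ![0, 0, -1]

/-- The integer vector `v` seen in Euclidean space. -/
noncomputable def vec (v : Fin 3 → ℤ) : E3 := WithLp.toLp 2 fun i => (v i : ℝ)

/-- The outward unit normal of a face. -/
noncomputable def normal (F : Face) : E3 := vec (normalZ F)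

/-- The (closed) square `F` of the unit cube
`{x | ∀ G, inner ℝ x (normal G) ≤ 1 / 2}` centred at the origin. -/
def face (F : Face) : Set E3 :=
  {x | inner ℝ x (normal F) = 1 / 2 ∧ ∀ G, inner ℝ x (normal G) ≤ 1 / 2}

/-- The relative interior of the square `F`. -/
def faceInterior (F : Face) : Set E3 :=
  {x | inner ℝ x (normal F) = 1 / 2 ∧ ∀ G, G ≠ F → inner ℝ x (normal G) < 1 / 2}

/-- The surface of the unit cube. -/
def surface : Set E3 := ⋃ F, face F

/-- Two faces are adjacent (share an edge). -/
def Adjacent (F G : Face) : Prop := dotProduct (normalZ F) (normalZ G) = 0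

/-- Two faces are opposite. -/
def IsOpposite (F G : Face) : Prop := normalZ G = -normalZ F

/-- Around `F`, seen from outside the cube, the neighbour `H` of `F` comes directly after the
neighbour `G` in counter-clockwise order. -/
def CcwNext (F G H : Face) : Prop := Adjacent F G ∧
  normalZ H = crossProduct (normalZ F) (normalZ G)

/-- The surface distance: the infimum of the lengths of the paths from `p` to `q` that run on
the surface of the cube (`⊤` if there is no such path of finite length). -/
noncomputable def surfaceDist (p q : E3) : ENNReal :=
  ⨅ (γ : Path p q) (_ : ∀ t, γ t ∈ surface), eVariationOn γ Set.univ

/-- For adjacent faces `F`, `G`: the rotation of space by a quarter turn about the line of the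
common edge of `F` and `G` which carries the plane of `G` to the plane of `F` and the face `G`
to the square on the other side of that edge from `F`, i.e. `G` is unfolded into the plane
of `F`.  Its linear part sends `normal G` to `normal F` and `normal F` to `-normal G`, and it
fixes the points with `inner ℝ x (normal F) = inner ℝ x (normal G) = 1 / 2`. -/
noncomputable def hinge (F G : Face) (x : E3) : E3 :=
  x + (inner ℝ x (normal G) - inner ℝ x (normal F)) • normal F
    + (1 - inner ℝ x (normal F) - inner ℝ x (normal G)) • normal G

/-- A net of the cube: the cube is cut along all edges except those dual to the edges of a
spanning tree `dual` of the face adjacency graph, and it is unfolded about the uncut edges into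
the plane of the face `base`, `place F` being the motion applied to the face `F`; the unfolded
faces must not overlap.  The graph `dual` is the dual graph of the net. -/
structure Net where
  dual : SimpleGraph Face
  isTree : dual.IsTree
  adjacent : ∀ F G, dual.Adj F G → Adjacent F G
  base : Face
  place : Face → E3 → E3
  place_base : place base = id
  place_unfold : ∀ F G, dual.Adj F G → place G = place F ∘ hinge F G
  no_overlap : ∀ F G, F ≠ G →
    Disjoint (place F '' faceInterior F) (place G '' faceInterior G)

/-- A landscape: at least two faces that form a path in the dual graph of some net, listed from
the origin face to the destination face. -/
def IsLandscape (L : List Face) : Prop :=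
  2 ≤ L.length ∧ L.Nodup ∧ ∃ N : Net, L.IsChain N.dual.Adj

/-- `L` is a landscape from the origin face `F` to the destination face `G`. -/
def IsLandscapeFromTo (L : List Face) (F G : Face) : Prop :=
  IsLandscape L ∧ L.head? = some F ∧ L.getLast? = some G

/-- `K` is a sublandscape of `L`: the subpath formed by some consecutive faces of `L`. -/
def IsSublandscape (K L : List Face) : Prop := IsLandscape K ∧ K <:+: L

/-- The point `p` of the cube lies in one of the faces of `L`. -/
def OnLandscape (L : List Face) (p : E3) : Prop := ∃ F ∈ L, p ∈ face F

/-- The motion which unfolds face number `k` (counted from `0`) of the list of faces into the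
plane of the first face, by successive unfoldings about the edges common to consecutive
faces. -/
noncomputable def develop : List Face → ℕ → E3 → E3
  | F :: G :: L, k + 1, x => hinge F G (develop (G :: L) k x)
  | _, _, x => x

/-- `a` is a copy of the point `p` in the unfolded landscape `L`: the image of `p`, viewed as a
point of one of the faces of `L` that contain it. -/
def IsCopy (L : List Face) (p a : E3) : Prop :=
  ∃ k F, L[k]? = some F ∧ p ∈ face F ∧ a = develop L k p

/-- The planar region formed by the unfolded landscape `L`. -/
def region (L : List Face) : Set E3 := {a | ∃ p, IsCopy L p a}

/-- The length of the trail from `p` to `q` in `L`: the length of the segment joining the copies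
of `p` and `q` in the unfolded landscape if it stays within that region, and `⊤` otherwise (if
there are several copies, the shortest segment is taken). -/
noncomputable def trailLength (L : List Face) (p q : E3) : ENNReal :=
  ⨅ (a : E3) (b : E3) (_ : IsCopy L p a) (_ : IsCopy L q b) (_ : segment ℝ a b ⊆ region L),
    edist a b

/-- The points `p`, `q` witness the validity of `L`: the surface distance of `p` and `q` is
attained by their trail in `L`, and no other landscape containing `p` and `q` with a trail of
the same length is a sublandscape of `L`. -/
def Witnesses (L : List Face) (p q : E3) : Prop :=
  OnLandscape L p ∧ OnLandscape L q ∧ trailLength L p q = surfaceDist p q ∧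
    ∀ K, IsLandscape K → K ≠ L → OnLandscape K p → OnLandscape K q →
      trailLength L p q = trailLength K p q → ¬ IsSublandscape K L

/-- Valid landscapes of the cube. -/
def IsValidLandscape (L : List Face) : Prop :=
  IsLandscape L ∧ ∃ p q, Witnesses L p q

/-- The relabellings `F1, …, F6 ↦ n F1, …, n F6` of the faces for which `n F1` and `n F6` are
opposite and `n F2, n F3, n F4, n F5` occur around `n F1` in the same counter-clockwise order
as `F2, F3, F4, F5` around `F1`. -/
def IsLabelling (n : Equiv.Perm Face) : Prop :=
  IsOpposite (n F1) (n F6) ∧ ∀ G H, CcwNext F1 G H → CcwNext (n F1) (n G) (n H)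

/-- The fifteen landscapes `L_1, …, L_15` (numbered here from `0`) for the labelling `n`. -/
def landscape (n : Equiv.Perm Face) : Fin 15 → List Face :=
  ![[n F1, n F2], [n F1, n F3, n F2], [n F1, n F4, n F2],
    [n F1, n F2, n F6], [n F1, n F3, n F6], [n F1, n F4, n F6], [n F1, n F5, n F6],
    [n F1, n F2, n F3, n F6], [n F1, n F3, n F5, n F6],
    [n F1, n F5, n F4, n F6], [n F1, n F4, n F2, n F6],
    [n F1, n F2, n F4, n F6], [n F1, n F3, n F2, n F6],
    [n F1, n F5, n F3, n F6], [n F1, n F4, n F5, n F6]]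

/-- For adjacent faces `F`, `G`: the point of the home-face `F` with coordinates `(x, y)` with
respect to the shared-face `G`, where, seen from outside the cube, the common edge of `F` and
`G` is the bottom edge of `F`, its left end is `(0, 0)` and its right end is `(1, 0)`. -/
noncomputable def pt (F G : Face) (x y : ℝ) : E3 :=
  (1 / 2 : ℝ) • normal F + (x - 1 / 2) • vec (crossProduct (normalZ F) (normalZ G))
    + (1 / 2 - y) • normal G

/-- The fifteen pairs of points, in the order of the landscapes. -/
noncomputable def witness (n : Equiv.Perm Face) : Fin 15 → E3 × E3 :=
  ![(pt (n F1) (n F2) (1 / 2) (1 / 5), pt (n F2) (n F1) (1 / 2) (1 / 5)),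
    (pt (n F1) (n F2) (1 / 10) (9 / 10), pt (n F2) (n F1) (9 / 10) (9 / 10)),
    (pt (n F1) (n F2) (9 / 10) (9 / 10), pt (n F2) (n F1) (1 / 10) (9 / 10)),
    (pt (n F1) (n F2) (1 / 2) (1 / 5), pt (n F6) (n F2) (1 / 2) (1 / 5)),
    (pt (n F1) (n F3) (1 / 2) (1 / 5), pt (n F6) (n F3) (1 / 2) (1 / 5)),
    (pt (n F1) (n F4) (1 / 2) (1 / 5), pt (n F6) (n F4) (1 / 2) (1 / 5)),
    (pt (n F1) (n F5) (1 / 2) (1 / 5), pt (n F6) (n F5) (1 / 2) (1 / 5)),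
    (pt (n F1) (n F2) (1 / 2) (1 / 10), pt (n F6) (n F2) (9 / 10) (1 / 2)),
    (pt (n F1) (n F3) (1 / 2) (1 / 10), pt (n F6) (n F3) (9 / 10) (1 / 2)),
    (pt (n F1) (n F5) (1 / 2) (1 / 10), pt (n F6) (n F5) (9 / 10) (1 / 2)),
    (pt (n F1) (n F4) (1 / 2) (1 / 10), pt (n F6) (n F4) (9 / 10) (1 / 2)),
    (pt (n F1) (n F2) (1 / 2) (1 / 10), pt (n F6) (n F2) (1 / 10) (1 / 2)),
    (pt (n F1) (n F3) (1 / 2) (1 / 10), pt (n F6) (n F3) (1 / 10) (1 / 2)),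
    (pt (n F1) (n F5) (1 / 2) (1 / 10), pt (n F6) (n F5) (1 / 10) (1 / 2)),
    (pt (n F1) (n F4) (1 / 2) (1 / 10), pt (n F6) (n F4) (1 / 10) (1 / 2))]

end CubeLandscape

open CubeLandscape

namespace CubeLandscape

open Face

/-! ### The finite type of faces -/

/-! Everything is done up to the 48 symmetries of the cube, which carry landscapes, trails,
distances and witnesses along. Up to symmetry the fifteen landscapes have four shapes: edge `[F1,
F2]`, corner `[F1, F3, F2]`, straight `[F1, F2, F6]` and zigzag `[F1, F2, F3, F6]`.

No other landscape is valid. When any path of faces is unfolded, two of its squares meet only inside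
all the squares between them (`IsFacePath.tilesMeetInOrder`, a finite check on lattice cells). Hence
a segment in the unfolding crosses the common edges in order and is at least as long as the surface
distance, and a shortest trail that misses the first or last face of a list of three or more faces
already lies in a shorter sublandscape. A symmetry moves a path of faces to a normal form, and all
normal forms except the four shapes contain a window (straight, hook, reversed hook, stairs, or one
of two windows read from an edge) whose trail can be compared with another unfolding. The other one
is never longer, and equality forces an end of the trail onto the first or last edge crossed, so
that the first or last face is superfluous (`eq_of_isValidLandscape_of_normal`). The comparison
rests on `surfaceDist_le_corner`: unfolding around a vertex bounds the surface distance even if the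
segment leaves the unfolded faces.

The four shapes are valid. Since the given points are interior to the end faces, no proper
sublandscape contains both, and it remains to show that their trail is shortest. For this, discs of
half the trail length are drawn about both points on the surface. If the images of one disc do not
overlap those of the other in the plane of any face, the difference of the two cone functions is
`1`-Lipschitz on each face and drops by at least the length of the trail between the points, so no
path on the surface is shorter (`le_surfaceDist_of_discs`). One net, unfolded along a path through
all six faces, contains all four shapes up to symmetry.

What remains is a finite check that the four shapes, moved by symmetries, are exactly the fifteen
lists of each labelling. -/

/-- The number of a face, counted from `0`. -/
def Face.toFin : Face → Fin 6
  | F1 => 0 | F2 => 1 | F3 => 2 | F4 => 3 | F5 => 4 | F6 => 5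

theorem Face.toFin_injective : Function.Injective Face.toFin := by
  intro a b h
  cases a <;> cases b <;> first | rfl | (exact absurd h (by decide))

/-- Together with finiteness this turns the combinatorial statements about faces below into finite
checks. -/
instance : DecidableEq Face := fun a b =>
  decidable_of_iff (a.toFin = b.toFin) Face.toFin_injective.eq_iff

instance : Fintype Face where
  elems := {F1, F2, F3, F4, F5, F6}
  complete := by intro F; cases F <;> decide

instance (F G : Face) : Decidable (Adjacent F G) :=
  inferInstanceAs (Decidable (dotProduct (normalZ F) (normalZ G) = 0))

instance (F G : Face) : Decidable (IsOpposite F G) :=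
  inferInstanceAs (Decidable (normalZ G = -normalZ F))

instance (F G H : Face) : Decidable (CcwNext F G H) :=
  inferInstanceAs (Decidable (_ ∧ _))

/-- The face opposite to a given one. -/
def opp : Face → Face
  | F1 => F6 | F2 => F5 | F3 => F4 | F4 => F3 | F5 => F2 | F6 => F1

theorem normal_opp (F : Face) : normal (opp F) = -normal F := by
  ext i
  cases F <;> fin_cases i <;> simp [normal, vec, normalZ, opp]

theorem inner_opp (F : Face) (x : E3) : inner ℝ x (normal (opp F)) = -inner ℝ x (normal F) := by
  rw [normal_opp, inner_neg_right]

/-! ### Coordinates -/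

@[simp] theorem inner_F1 (x : E3) : inner ℝ x (normal F1) = x 2 := by
  simp [normal, vec, normalZ, PiLp.inner_apply, Fin.sum_univ_three]
@[simp] theorem inner_F2 (x : E3) : inner ℝ x (normal F2) = -x 1 := by
  simp [normal, vec, normalZ, PiLp.inner_apply, Fin.sum_univ_three]
@[simp] theorem inner_F3 (x : E3) : inner ℝ x (normal F3) = -x 0 := by
  simp [normal, vec, normalZ, PiLp.inner_apply, Fin.sum_univ_three]
@[simp] theorem inner_F4 (x : E3) : inner ℝ x (normal F4) = x 0 := by
  simp [normal, vec, normalZ, PiLp.inner_apply, Fin.sum_univ_three]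
@[simp] theorem inner_F5 (x : E3) : inner ℝ x (normal F5) = x 1 := by
  simp [normal, vec, normalZ, PiLp.inner_apply, Fin.sum_univ_three]
@[simp] theorem inner_F6 (x : E3) : inner ℝ x (normal F6) = -x 2 := by
  simp [normal, vec, normalZ, PiLp.inner_apply, Fin.sum_univ_three]

theorem forall_face {p : Face → Prop} :
    (∀ F, p F) ↔ p F1 ∧ p F2 ∧ p F3 ∧ p F4 ∧ p F5 ∧ p F6 := by
  refine ⟨fun h => ⟨h _, h _, h _, h _, h _, h _⟩, ?_⟩
  rintro ⟨h1, h2, h3, h4, h5, h6⟩ F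
  cases F <;> assumption

theorem mem_face {F : Face} {x : E3} : x ∈ face F ↔ inner ℝ x (normal F) = 1 / 2 ∧
    (x 0 ≤ 1 / 2 ∧ -(1 / 2) ≤ x 0) ∧ (x 1 ≤ 1 / 2 ∧ -(1 / 2) ≤ x 1) ∧
      (x 2 ≤ 1 / 2 ∧ -(1 / 2) ≤ x 2) := by
  simp only [face, Set.mem_ofPred_eq, forall_face, inner_F1, inner_F2, inner_F3, inner_F4,
    inner_F5, inner_F6]
  constructor
  · rintro ⟨h, h1, h2, h3, h4, h5, h6⟩
    exact ⟨h, ⟨h4, by linarith⟩, ⟨h5, by linarith⟩, ⟨h1, by linarith⟩⟩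
  · rintro ⟨h, ⟨h1, h2⟩, ⟨h3, h4⟩, ⟨h5, h6⟩⟩
    exact ⟨h, h5, by linarith, by linarith, h1, h3, by linarith⟩

theorem convex_face (F : Face) : Convex ℝ (face F) := by
  intro x hx y hy a b ha hb hab
  simp only [face, Set.mem_ofPred_eq, inner_add_left, inner_smul_left, RCLike.conj_to_real] at *
  refine ⟨by rw [hx.1, hy.1, ← add_mul, hab, one_mul], fun G => ?_⟩
  calc a * inner ℝ x (normal G) + b * inner ℝ y (normal G) ≤ a * (1 / 2) + b * (1 / 2) := by
        gcongr
        · exact hx.2 G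
        · exact hy.2 G
    _ = 1 / 2 := by rw [← add_mul, hab, one_mul]

theorem isClosed_face (F : Face) : IsClosed (face F) := by
  have : face F = {x | inner ℝ x (normal F) = 1 / 2} ∩ ⋂ G, {x | inner ℝ x (normal G) ≤ 1 / 2} := by
    ext x; simp [face]
  rw [this]
  refine (isClosed_eq (by fun_prop) (by fun_prop)).inter (isClosed_iInter fun G => ?_)
  exact isClosed_le (by fun_prop) (by fun_prop)

theorem face_subset_surface (F : Face) : face F ⊆ surface := Set.subset_iUnion _ F

theorem sq_dist (x y : E3) :
    dist x y ^ 2 = (x 0 - y 0) ^ 2 + (x 1 - y 1) ^ 2 + (x 2 - y 2) ^ 2 := by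
  rw [EuclideanSpace.dist_sq_eq]
  simp [Fin.sum_univ_three, Real.dist_eq, sq_abs]

theorem ext_coord {x y : E3} (h0 : x 0 = y 0) (h1 : x 1 = y 1) (h2 : x 2 = y 2) : x = y := by
  ext i; fin_cases i <;> assumption

theorem isCompact_face (F : Face) : IsCompact (face F) := by
  refine Metric.isCompact_of_isClosed_isBounded (isClosed_face F) ?_
  refine (Metric.isBounded_iff_subset_closedBall (0 : E3)).2 ⟨1, fun x hx => ?_⟩
  obtain ⟨-, ⟨h1, h2⟩, ⟨h3, h4⟩, h5, h6⟩ := mem_face.1 hx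
  rw [Metric.mem_closedBall, ← sq_le_sq₀ dist_nonneg zero_le_one, sq_dist]
  simp only [PiLp.zero_apply]
  nlinarith

/-! ### Unfolding about an edge -/

theorem inner_normal_normal (F G : Face) :
    inner ℝ (normal F) (normal G) = ((dotProduct (normalZ F) (normalZ G) : ℤ) : ℝ) := by
  simp [normal, vec, PiLp.inner_apply, Fin.sum_univ_three, dotProduct, mul_comm]

theorem inner_normal_self (F : Face) : inner ℝ (normal F) (normal F) = (1 : ℝ) := by
  rw [inner_normal_normal, show dotProduct (normalZ F) (normalZ F) = 1 by cases F <;> decide]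
  simp

theorem inner_normal_of_adjacent {F G : Face} (h : Adjacent F G) :
    inner ℝ (normal F) (normal G) = (0 : ℝ) := by
  rw [inner_normal_normal, show dotProduct (normalZ F) (normalZ G) = 0 from h]
  simp

theorem Adjacent.symm {F G : Face} (h : Adjacent F G) : Adjacent G F := by
  unfold Adjacent at *; rwa [dotProduct_comm]

theorem inner_hinge_left {F G : Face} (h : Adjacent F G) (x : E3) :
    inner ℝ (hinge F G x) (normal F) = inner ℝ x (normal G) := by
  simp only [hinge, inner_add_left, inner_smul_left, RCLike.conj_to_real, inner_normal_self,
    inner_normal_of_adjacent h.symm]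
  ring

theorem inner_hinge_right {F G : Face} (h : Adjacent F G) (x : E3) :
    inner ℝ (hinge F G x) (normal G) = 1 - inner ℝ x (normal F) := by
  simp only [hinge, inner_add_left, inner_smul_left, RCLike.conj_to_real, inner_normal_self,
    inner_normal_of_adjacent h]
  ring

theorem inner_hinge_other {F G H : Face} (hF : Adjacent F H) (hG : Adjacent G H) (x : E3) :
    inner ℝ (hinge F G x) (normal H) = inner ℝ x (normal H) := by
  simp only [hinge, inner_add_left, inner_smul_left, RCLike.conj_to_real,
    inner_normal_of_adjacent hF, inner_normal_of_adjacent hG]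
  ring

theorem hinge_eq_self {F G : Face} {x : E3} (hF : inner ℝ x (normal F) = 1 / 2)
    (hG : inner ℝ x (normal G) = 1 / 2) : hinge F G x = x := by
  simp only [hinge, hF, hG]; norm_num

/-- If the copies of a point of `F` and a point of `G` agree after unfolding `G` into the plane
of `F`, these points coincide. -/
theorem eq_of_hinge_mem_face {F G : Face} (h : Adjacent F G) {x y : E3} (hx : x ∈ face F)
    (hy : y ∈ face G) (hxy : x = hinge F G y) : x = y := by
  -- The coordinate of `x` towards `G` and that of `y` towards `F` add up to `1` and are both at
  -- most `1 / 2`. So `y` lies on the common edge, which the hinge fixes.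
  have h1 := inner_hinge_right h y
  rw [← hxy] at h1
  have h2 := hx.2 G
  have h3 := hy.2 F
  rw [hxy]
  exact hinge_eq_self (by linarith) hy.1

/-- The unfolding about an edge as an affine isometry. -/
theorem exists_affineIsometry_hinge {F G : Face} (h : Adjacent F G) :
    ∃ φ : E3 →ᵃⁱ[ℝ] E3, ⇑φ = hinge F G := by
  let ℓ : E3 →ₗ[ℝ] E3 :=
    { toFun := fun x => x + (inner ℝ x (normal G) - inner ℝ x (normal F)) • normal F
        + (- inner ℝ x (normal F) - inner ℝ x (normal G)) • normal G
      map_add' := fun x y => by simp only [inner_add_left]; module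
      map_smul' := fun c x => by
        simp only [inner_smul_left, RCLike.conj_to_real, RingHom.id_apply]; module }
  let A : E3 →ᵃ[ℝ] E3 :=
    { toFun := hinge F G
      linear := ℓ
      map_vadd' := fun x v => by
        simp only [hinge, ℓ, vadd_eq_add, inner_add_left, LinearMap.coe_mk, AddHom.coe_mk]
        module }
  refine ⟨⟨A, fun x => ?_⟩, rfl⟩
  change ‖ℓ x‖ = ‖x‖
  have hFF := inner_normal_self F
  have hGG := inner_normal_self G
  have hFG := inner_normal_of_adjacent h
  have hGF := inner_normal_of_adjacent h.symm
  have : inner ℝ (ℓ x) (ℓ x) = inner ℝ x x := by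
    simp only [ℓ, LinearMap.coe_mk, AddHom.coe_mk, inner_add_left, inner_add_right,
      inner_smul_left, inner_smul_right, RCLike.conj_to_real, hFF, hGG, hFG, hGF,
      real_inner_comm x (normal F), real_inner_comm x (normal G)]
    ring
  rw [norm_eq_sqrt_real_inner, this, ← norm_eq_sqrt_real_inner]

theorem exists_affineIsometry_develop : ∀ {L : List Face}, L.IsChain Adjacent → ∀ k,
    ∃ φ : E3 →ᵃⁱ[ℝ] E3, ⇑φ = develop L k
  | [], _, _ => ⟨AffineIsometry.id, by ext; simp [develop]⟩
  | [_], _, _ => ⟨AffineIsometry.id, by ext; simp [develop]⟩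
  | _ :: _ :: _, _, 0 => ⟨AffineIsometry.id, by ext; simp [develop]⟩
  | F :: G :: L, hL, k + 1 => by
    rw [List.isChain_cons_cons] at hL
    obtain ⟨φ, hφ⟩ := exists_affineIsometry_develop hL.2 k
    obtain ⟨ψ, hψ⟩ := exists_affineIsometry_hinge hL.1
    refine ⟨ψ.comp φ, ?_⟩
    rw [AffineIsometry.coe_comp, hφ, hψ]
    rfl

@[simp] theorem develop_zero (L : List Face) (x : E3) : develop L 0 x = x := by
  match L with
  | [] => rfl
  | [_] => rfl
  | _ :: _ :: _ => rfl

@[simp] theorem develop_cons_cons_succ (F G : Face) (L : List Face) (k : ℕ) (x : E3) :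
    develop (F :: G :: L) (k + 1) x = hinge F G (develop (G :: L) k x) := rfl

theorem dist_develop {L : List Face} (hL : L.IsChain Adjacent) (k : ℕ) (x y : E3) :
    dist (develop L k x) (develop L k y) = dist x y := by
  obtain ⟨φ, hφ⟩ := exists_affineIsometry_develop hL k
  rw [← hφ, φ.dist_map]

theorem dist_hinge {F G : Face} (h : Adjacent F G) (x y : E3) :
    dist (hinge F G x) (hinge F G y) = dist x y := by
  obtain ⟨φ, hφ⟩ := exists_affineIsometry_hinge h
  rw [← hφ, φ.dist_map]

/-- Consecutive faces of an unfolded list of faces are glued along their common edge only. -/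
theorem eq_of_develop_eq_develop_succ : ∀ {L : List Face}, L.IsChain Adjacent → ∀ {k : ℕ}
    {F G : Face}, L[k]? = some F → L[k + 1]? = some G → ∀ {x y : E3}, x ∈ face F → y ∈ face G →
    develop L k x = develop L (k + 1) y → x = y
  | [], _, _, _, _, hF, _, _, _, _, _, _ => by simp at hF
  | [_], _, k, _, _, _, hG, _, _, _, _, _ => by simp at hG
  | A :: B :: L, hL, 0, F, G, hF, hG, x, y, hx, hy, h => by
    rw [List.isChain_cons_cons] at hL
    simp at hF hG
    subst hF hG
    simp at h
    exact eq_of_hinge_mem_face hL.1 hx hy h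
  | A :: B :: L, hL, k + 1, F, G, hF, hG, x, y, hx, hy, h => by
    rw [List.isChain_cons_cons] at hL
    refine eq_of_develop_eq_develop_succ hL.2 (k := k) (by simpa using hF) (by simpa using hG)
      hx hy ?_
    obtain ⟨φ, hφ⟩ := exists_affineIsometry_hinge hL.1
    rw [develop_cons_cons_succ, develop_cons_cons_succ, ← hφ] at h
    exact φ.injective h

/-- A point common to consecutive faces has one copy in their unfoldings. -/
theorem develop_eq_develop_succ : ∀ {L : List Face} {k : ℕ}
    {F G : Face}, L[k]? = some F → L[k + 1]? = some G → ∀ {x : E3}, x ∈ face F → x ∈ face G →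
    develop L (k + 1) x = develop L k x
  | [], _, _, _, hF, _, _, _, _ => by simp at hF
  | [_], k, _, _, _, hG, _, _, _ => by simp at hG
  | A :: B :: L, 0, F, G, hF, hG, x, hx, hy => by
    simp at hF hG
    subst hF hG
    simp [hinge_eq_self hx.1 hy.1]
  | A :: B :: L, k + 1, F, G, hF, hG, x, hx, hy => by
    rw [develop_cons_cons_succ, develop_cons_cons_succ,
      develop_eq_develop_succ (k := k) (by simpa using hF) (by simpa using hG) hx hy]


/-! ### The surface distance -/

theorem surfaceDist_le_edist {F : Face} {p q : E3} (hp : p ∈ face F) (hq : q ∈ face F) :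
    surfaceDist p q ≤ edist p q := by
  let γ : Path p q :=
    { toFun := fun t => AffineMap.lineMap p q (t : ℝ)
      continuous_toFun := by fun_prop
      source' := by simp
      target' := by simp }
  refine (iInf₂_le γ fun t => face_subset_surface F ?_).trans ?_
  · exact (convex_face F).segment_subset hp hq
      (by rw [segment_eq_image_lineMap]; exact ⟨t, t.2, rfl⟩)
  · have h1 : LipschitzOnWith (nndist p q) (fun t : ℝ => AffineMap.lineMap p q t) Set.univ := by
      refine (LipschitzWith.of_dist_le_mul fun s t => ?_).lipschitzOnWith
      rw [dist_lineMap_lineMap, mul_comm]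
      rfl
    have h2 := h1.comp_eVariationOn_le (g := fun t : unitInterval => (t : ℝ))
      (s := Set.univ) (fun _ _ => Set.mem_univ _)
    have h3 : eVariationOn (Subtype.val : unitInterval → ℝ) Set.univ ≤ 1 := by
      have := MonotoneOn.eVariationOn_eq (f := (Subtype.val : unitInterval → ℝ)) (s := Set.univ)
        (fun a _ b _ hab => hab) (Set.mem_univ 0) (Set.mem_univ 1)
      have h01 : Set.Icc (0 : unitInterval) 1 = Set.univ :=
        Set.eq_univ_of_forall fun t => ⟨unitInterval.nonneg', unitInterval.le_one'⟩
      simpa [h01] using this.le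
    calc eVariationOn γ Set.univ ≤ nndist p q * eVariationOn Subtype.val Set.univ := h2
      _ ≤ nndist p q * 1 := by gcongr
      _ = edist p q := by rw [mul_one, edist_nndist]

theorem surfaceDist_comm (p q : E3) : surfaceDist p q = surfaceDist q p := by
  have key : ∀ p q : E3, surfaceDist p q ≤ surfaceDist q p := by
    intro p q
    refine le_iInf₂ fun γ hγ => (iInf₂_le γ.symm fun t => hγ _).trans ?_
    exact eVariationOn.comp_le_of_antitoneOn γ unitInterval.symm
      (fun a _ b _ hab => unitInterval.symm_le_symm.2 hab) (fun _ _ => Set.mem_univ _)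
  exact le_antisymm (key p q) (key q p)

/-- On each half of the parameter interval the concatenation is one of the two paths composed with a
monotone map, which cannot increase the variation. -/
theorem eVariationOn_trans_le {p q r : E3} (γ : Path p q) (γ' : Path q r) :
    eVariationOn (γ.trans γ') Set.univ ≤ eVariationOn γ Set.univ + eVariationOn γ' Set.univ := by
  let m : unitInterval := ⟨1 / 2, by norm_num, by norm_num⟩
  have hu : (Set.univ : Set unitInterval) = Set.Iic m ∪ Set.Ici m := by
    ext t; simp
  rw [hu, eVariationOn.union (x := m) _ ⟨Set.mem_Iic.2 le_rfl, fun _ h => h⟩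
    ⟨Set.mem_Ici.2 le_rfl, fun _ h => h⟩, ← hu]
  refine add_le_add ?_ ?_
  · have h : Set.EqOn (γ.trans γ')
        (γ ∘ fun t => Set.projIcc (0 : ℝ) 1 zero_le_one (2 * (t : ℝ))) (Set.Iic m) := by
      intro t ht
      have ht' : (t : ℝ) ≤ 1 / 2 := ht
      rw [Path.trans_apply, dif_pos ht', Function.comp_apply, Set.projIcc_of_mem]
    rw [eVariationOn.eq_of_eqOn h]
    refine eVariationOn.comp_le_of_monotoneOn γ _ (fun a _ b _ hab => ?_)
      (fun _ _ => Set.mem_univ _)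
    exact Set.monotone_projIcc _ (mul_le_mul_of_nonneg_left hab zero_le_two)
  · have h : Set.EqOn (γ.trans γ')
        (γ' ∘ fun t => Set.projIcc (0 : ℝ) 1 zero_le_one (2 * (t : ℝ) - 1)) (Set.Ici m) := by
      intro t ht
      have ht' : 1 / 2 ≤ (t : ℝ) := ht
      rw [Path.trans_apply, Function.comp_apply]
      split_ifs with hle
      · have : (t : ℝ) = 1 / 2 := le_antisymm hle ht'
        rw [show (Set.projIcc (0 : ℝ) 1 zero_le_one (2 * (t : ℝ) - 1)) = 0 by
          rw [this, Set.projIcc_of_le_left _ (by norm_num)]; rfl, γ'.source]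
        have : (⟨2 * (t : ℝ), by linarith, by linarith⟩ : unitInterval) = 1 := by
          ext; simp [this]
        rw [this, γ.target]
      · rw [Set.projIcc_of_mem]
    rw [eVariationOn.eq_of_eqOn h]
    refine eVariationOn.comp_le_of_monotoneOn γ' _ (fun a _ b _ hab => ?_)
      (fun _ _ => Set.mem_univ _)
    have hab' : (a : ℝ) ≤ b := hab
    exact Set.monotone_projIcc _ (by linarith)

theorem surfaceDist_triangle (p q r : E3) :
    surfaceDist p r ≤ surfaceDist p q + surfaceDist q r := by
  unfold surfaceDist
  refine ENNReal.le_of_forall_pos_le_add fun ε hε hlt => ?_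
  have hε2 : (ε / 2 : ENNReal) ≠ 0 := by simpa using hε.ne'
  have h1 := ENNReal.lt_add_right (ne_top_of_le_ne_top hlt.ne le_self_add) hε2
  have h2 := ENNReal.lt_add_right (ne_top_of_le_ne_top hlt.ne le_add_self) hε2
  obtain ⟨γ, hγ, h1⟩ := by simpa only [iInf_lt_iff, exists_prop] using h1
  obtain ⟨γ', hγ', h2⟩ := by simpa only [iInf_lt_iff, exists_prop] using h2
  refine (iInf₂_le (γ.trans γ') fun t => ?_).trans ((eVariationOn_trans_le γ γ').trans ?_)
  · have : γ.trans γ' t ∈ Set.range γ ∪ Set.range γ' := by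
      rw [← Path.trans_range]; exact ⟨t, rfl⟩
    rcases this with ⟨s, hs⟩ | ⟨s, hs⟩
    · exact hs ▸ hγ s
    · exact hs ▸ hγ' s
  · refine (add_le_add h1.le h2.le).trans (le_of_eq ?_)
    rw [add_add_add_comm, ENNReal.add_halves]

/-! ### Lower bounds for the surface distance by Lipschitz functions -/

/-- Sum of the increments over a finite closed cover of an interval. -/
theorem edist_le_eVariationOn_of_cover {α E : Type*} [PseudoEMetricSpace α]
    [PseudoEMetricSpace E] {ι : Type*} [DecidableEq ι] {γ : unitInterval → E}
    {C : ι → Set unitInterval} (hC : ∀ i, IsClosed (C i)) {f : unitInterval → α}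
    (hf : ∀ i, ∀ s ∈ C i, ∀ t ∈ C i, edist (f s) (f t) ≤ edist (γ s) (γ t)) :
    ∀ (S : Finset ι) {u v : unitInterval}, u ≤ v → (∀ t ∈ Set.Icc u v, ∃ i ∈ S, t ∈ C i) →
      edist (f u) (f v) ≤ eVariationOn γ (Set.Icc u v) := by
  intro S
  induction S using Finset.strongInduction with
  | H S ih =>
    intro u v huv hcov
    obtain ⟨i, hi, hui⟩ := hcov u ⟨le_rfl, huv⟩
    have hcomp : IsCompact (C i ∩ Set.Icc u v) := isCompact_Icc.inter_left (hC i)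
    -- `s` is the last time spent in `C i`, so that the rest of the interval can do without this
    -- set.
    obtain ⟨s, ⟨hsi, hus, hsv⟩, hmax⟩ := hcomp.exists_isGreatest ⟨u, hui, le_rfl, huv⟩
    have h1 : edist (f u) (f s) ≤ eVariationOn γ (Set.Icc u s) :=
      (hf i u hui s hsi).trans (eVariationOn.edist_le _ ⟨le_rfl, hus⟩ ⟨hus, le_rfl⟩)
    rcases hsv.eq_or_lt with rfl | hlt
    · exact h1
    have h2 : edist (f s) (f v) ≤ eVariationOn γ (Set.Icc s v) := by
      refine ih (S.erase i) (Finset.erase_ssubset hi) hsv ?_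
      -- The other sets cover the times after `s`; as their union is closed, it also contains `s`.
      have hcl : IsClosed (⋃ j ∈ S.erase i, C j) :=
        Set.Finite.isClosed_biUnion (S.erase i).finite_toSet fun j _ => hC j
      have hsub : Set.Ioc s v ⊆ ⋃ j ∈ S.erase i, C j := by
        intro t ht
        obtain ⟨j, hj, htj⟩ := hcov t ⟨hus.trans ht.1.le, ht.2⟩
        refine Set.mem_biUnion (Finset.mem_coe.2 (Finset.mem_erase.2 ⟨?_, hj⟩)) htj
        rintro rfl
        exact (hmax ⟨htj, hus.trans ht.1.le, ht.2⟩).not_gt ht.1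
      intro t ht
      have := hcl.closure_subset_iff.2 hsub (by rwa [closure_Ioc hlt.ne])
      simpa only [Set.mem_iUnion, exists_prop] using this
    calc edist (f u) (f v) ≤ edist (f u) (f s) + edist (f s) (f v) := edist_triangle _ _ _
      _ ≤ eVariationOn γ (Set.Icc u s) + eVariationOn γ (Set.Icc s v) := add_le_add h1 h2
      _ = eVariationOn γ (Set.Icc u v) := by
        simpa using eVariationOn.Icc_add_Icc γ (s := Set.univ) hus hsv (Set.mem_univ s)

/-- A function which is `1`-Lipschitz on every face bounds the surface distance from below. -/
theorem le_surfaceDist_of_lipschitz {f : Face → E3 → ℝ}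
    (hf : ∀ F, ∀ x ∈ face F, ∀ y ∈ face F, dist (f F x) (f F y) ≤ dist x y)
    (hfg : ∀ F G x, x ∈ face F → x ∈ face G → f F x = f G x) {F G : Face} {p q : E3}
    (hp : p ∈ face F) (hq : q ∈ face G) : edist (f F p) (f G q) ≤ surfaceDist p q := by
  refine le_iInf₂ fun γ hγ => ?_
  have hγ' : ∀ t, ∃ F, γ t ∈ face F := fun t => Set.mem_iUnion.1 (hγ t)
  -- The choice of a face at each time is arbitrary: by `hfg` it does not affect the value of `f`.
  choose c hc using hγ'
  have h01 : Set.Icc (0 : unitInterval) 1 = Set.univ :=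
    Set.eq_univ_of_forall fun t => ⟨unitInterval.nonneg', unitInterval.le_one'⟩
  have := edist_le_eVariationOn_of_cover (γ := γ) (C := fun F => γ ⁻¹' face F)
    (f := fun t => f (c t) (γ t)) (fun F => (isClosed_face F).preimage γ.continuous)
    (fun F s hs t ht => by
      rw [hfg _ F _ (hc s) hs, hfg _ F _ (hc t) ht, edist_dist, edist_dist]
      exact ENNReal.ofReal_le_ofReal (hf F _ hs _ ht))
    Finset.univ (u := 0) (v := 1) zero_le_one
    (fun t _ => ⟨c t, Finset.mem_univ _, hc t⟩)
  have h0 := hc 0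
  have h1 := hc 1
  rw [γ.source] at h0
  rw [γ.target] at h1
  rwa [h01, γ.source, γ.target, hfg _ F _ h0 hp, hfg _ G _ h1 hq] at this

/-- The height at `x` of the highest of the cones of slope `1` and height `r` over the points
of a list, cut off at `0`. -/
noncomputable def cone (r : ℝ) (A : List E3) (x : E3) : ℝ :=
  A.foldr (fun a m => max (r - dist x a) m) 0

theorem cone_nonneg (r : ℝ) (A : List E3) (x : E3) : 0 ≤ cone r A x := by
  induction A with
  | nil => exact le_rfl
  | cons a A ih => exact le_max_of_le_right ih

theorem le_cone {r : ℝ} {A : List E3} {a : E3} (ha : a ∈ A) (x : E3) :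
    r - dist x a ≤ cone r A x := by
  induction A with
  | nil => simp at ha
  | cons b A ih =>
    rcases List.mem_cons.1 ha with rfl | ha
    · exact le_max_left _ _
    · exact le_max_of_le_right (ih ha)

theorem cone_eq (r : ℝ) (A : List E3) (x : E3) :
    cone r A x = 0 ∨ ∃ a ∈ A, cone r A x = r - dist x a := by
  induction A with
  | nil => exact Or.inl rfl
  | cons b A ih =>
    change max (r - dist x b) (cone r A x) = 0 ∨ ∃ a ∈ b :: A, max _ (cone r A x) = r - dist x a
    rcases max_choice (r - dist x b) (cone r A x) with h | h <;> rw [h]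
    · exact Or.inr ⟨b, by simp, rfl⟩
    · rcases ih with h | ⟨a, ha, h⟩
      · exact Or.inl h
      · exact Or.inr ⟨a, by simp [ha], h⟩

theorem cone_sub_cone_le (r : ℝ) (A : List E3) (x y : E3) :
    cone r A x - cone r A y ≤ dist x y := by
  rcases cone_eq r A x with h | ⟨a, ha, h⟩
  · linarith [cone_nonneg r A y, dist_nonneg (x := x) (y := y)]
  · linarith [le_cone (r := r) ha y, dist_triangle_left y a x, dist_comm x y]

theorem cone_le_cone {r : ℝ} {A B : List E3} {x : E3}
    (h : ∀ a ∈ A, dist x a < r → ∃ b ∈ B, dist x b ≤ dist x a) : cone r A x ≤ cone r B x := by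
  rcases cone_eq r A x with h0 | ⟨a, ha, h0⟩
  · exact h0 ▸ cone_nonneg r B x
  · rcases lt_or_ge (dist x a) r with hlt | hge
    · obtain ⟨b, hb, hab⟩ := h a ha hlt
      linarith [le_cone (r := r) hb x]
    · linarith [cone_nonneg r B x]

/-- If the points of `A F` and `B F` are the images of `p` and `q` in the planes of the faces
from which the discs of radius `r` about `p` and `q` are seen, and these discs do not overlap,
then `p` and `q` have surface distance at least `2 * r`. -/
theorem le_surfaceDist_of_discs {r : ℝ} (hr : 0 ≤ r) {A B : Face → List E3}
    (hA : ∀ F G x, x ∈ face F → x ∈ face G → ∀ a ∈ A F, dist x a < r →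
      ∃ b ∈ A G, dist x b ≤ dist x a)
    (hB : ∀ F G x, x ∈ face F → x ∈ face G → ∀ a ∈ B F, dist x a < r →
      ∃ b ∈ B G, dist x b ≤ dist x a)
    (hAB : ∀ F, ∀ a ∈ A F, ∀ b ∈ B F, 2 * r ≤ dist a b) {F G : Face} {p q : E3}
    (hp : p ∈ face F) (hq : q ∈ face G) (hpA : p ∈ A F) (hqB : q ∈ B G) :
    ENNReal.ofReal (2 * r) ≤ surfaceDist p q := by
  -- The critical case is `x` on the cone of `a` and `y` on the cone of `b`. There the left side is
  -- at most `2 * r - dist x a - dist y b ≤ dist a b - dist x a - dist y b ≤ dist x y`.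
  have key : ∀ F, ∀ x y : E3, (cone r (A F) x - cone r (B F) x)
      - (cone r (A F) y - cone r (B F) y) ≤ dist x y := by
    intro F x y
    have hx := cone_sub_cone_le r (A F) x y
    have hy := cone_sub_cone_le r (B F) y x
    rw [dist_comm] at hy
    rcases cone_eq r (A F) x with h | ⟨a, ha, h⟩
    · linarith [cone_nonneg r (A F) y]
    rcases cone_eq r (B F) y with h' | ⟨b, hb, h'⟩
    · linarith [cone_nonneg r (B F) x]
    linarith [hAB F a ha b hb, cone_nonneg r (A F) y, cone_nonneg r (B F) x,
      dist_triangle_left a b x, dist_triangle x y b]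
  have hle := le_surfaceDist_of_lipschitz
    (f := fun F x => cone r (A F) x - cone r (B F) x)
    (fun F x _ y _ => by
      rw [Real.dist_eq, abs_le]
      constructor
      · linarith [key F y x, dist_comm x y]
      · exact key F x y)
    (fun F G x hF hG => by
      rw [le_antisymm (cone_le_cone (hA F G x hF hG)) (cone_le_cone (hA G F x hG hF)),
        le_antisymm (cone_le_cone (hB F G x hF hG)) (cone_le_cone (hB G F x hG hF))]) hp hq
  refine le_trans ?_ hle
  rw [edist_dist]
  refine ENNReal.ofReal_le_ofReal (le_trans ?_ (le_abs_self _))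
  have hd : ∀ {G : Face} {a b : E3}, a ∈ A G → b ∈ B G → 2 * r ≤ dist a b :=
    fun ha hb => hAB _ _ ha _ hb
  -- The difference of the cones is at least `r` at `p` and at most `-r` at `q`, since each point is
  -- farther than `r` (or `r = 0`) from all images of the other in its own face.
  have hAp : r ≤ cone r (A F) p := by simpa using le_cone (r := r) hpA p
  have hBq : r ≤ cone r (B G) q := by simpa using le_cone (r := r) hqB q
  have hBp : cone r (B F) p ≤ 0 := by
    rcases cone_eq r (B F) p with h | ⟨b, hb, h⟩
    · exact h.le
    · linarith [hd hpA hb]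
  have hAq : cone r (A G) q ≤ 0 := by
    rcases cone_eq r (A G) q with h | ⟨a, ha, h⟩
    · exact h.le
    · linarith [hd ha hqB, dist_comm q a]
  linarith


/-! ### Symmetries of the cube -/

/-- A symmetry of the cube: a linear isometry of space and the permutation of the faces which it
induces. -/
structure Symmetry where
  perm : Equiv.Perm Face
  motion : E3 ≃ₗᵢ[ℝ] E3
  map_normal : ∀ F, motion (normal F) = normal (perm F)

namespace Symmetry

/-- The inverse symmetry. -/
noncomputable def symm (T : Symmetry) : Symmetry where
  perm := T.perm.symm
  motion := T.motion.symm
  map_normal F := by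
    rw [LinearIsometryEquiv.symm_apply_eq, T.map_normal, Equiv.apply_symm_apply]

theorem inner_motion (T : Symmetry) (F : Face) (x : E3) :
    inner ℝ (T.motion x) (normal (T.perm F)) = inner ℝ x (normal F) := by
  rw [← T.map_normal, LinearIsometryEquiv.inner_map_map]

theorem mem_face_iff (T : Symmetry) {F : Face} {x : E3} :
    T.motion x ∈ face (T.perm F) ↔ x ∈ face F := by
  simp only [face, Set.mem_ofPred_eq, T.inner_motion]
  rw [← T.perm.forall_congr_right]
  simp only [T.inner_motion]

theorem mem_faceInterior_iff (T : Symmetry) {F : Face} {x : E3} :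
    T.motion x ∈ faceInterior (T.perm F) ↔ x ∈ faceInterior F := by
  simp only [faceInterior, Set.mem_ofPred_eq, T.inner_motion]
  rw [← T.perm.forall_congr_right]
  simp only [T.inner_motion, T.perm.injective.ne_iff]

theorem motion_hinge (T : Symmetry) (F G : Face) (x : E3) :
    T.motion (hinge F G x) = hinge (T.perm F) (T.perm G) (T.motion x) := by
  simp only [hinge, map_add, map_smul, T.map_normal, T.inner_motion]

theorem motion_develop (T : Symmetry) : ∀ (L : List Face) (k : ℕ) (x : E3),
    T.motion (develop L k x) = develop (L.map T.perm) k (T.motion x)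
  | [], _, _ => rfl
  | [_], _, _ => rfl
  | _ :: _ :: _, 0, _ => rfl
  | F :: G :: L, k + 1, x => by
    have := T.motion_develop (G :: L) k x
    rw [List.map_cons] at this
    rw [List.map_cons, List.map_cons, develop_cons_cons_succ, develop_cons_cons_succ,
      motion_hinge, this]

theorem isCopy_map (T : Symmetry) {L : List Face} {p a : E3} (h : IsCopy L p a) :
    IsCopy (L.map T.perm) (T.motion p) (T.motion a) := by
  obtain ⟨k, F, hk, hp, rfl⟩ := h
  exact ⟨k, T.perm F, by simp [hk], T.mem_face_iff.2 hp, T.motion_develop L k p⟩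

theorem isCopy_map_iff (T : Symmetry) {L : List Face} {p a : E3} :
    IsCopy (L.map T.perm) (T.motion p) (T.motion a) ↔ IsCopy L p a := by
  refine ⟨fun h => ?_, T.isCopy_map⟩
  simpa [symm] using T.symm.isCopy_map h

theorem region_map (T : Symmetry) (L : List Face) :
    region (L.map T.perm) = T.motion '' region L := by
  ext a
  constructor
  · rintro ⟨p, hp⟩
    refine ⟨T.motion.symm a, ⟨T.motion.symm p, ?_⟩, by simp⟩
    rw [← T.isCopy_map_iff]
    simpa using hp
  · rintro ⟨a, ⟨p, hp⟩, rfl⟩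
    exact ⟨_, T.isCopy_map hp⟩

theorem segment_subset_region_iff (T : Symmetry) {L : List Face} {a b : E3} :
    segment ℝ (T.motion a) (T.motion b) ⊆ region (L.map T.perm) ↔
      segment ℝ a b ⊆ region L := by
  have : segment ℝ (T.motion a) (T.motion b) = T.motion '' segment ℝ a b :=
    (image_segment ℝ T.motion.toLinearEquiv.toLinearMap.toAffineMap a b).symm
  rw [this, T.region_map, Set.image_subset_image_iff T.motion.injective]

theorem trailLength_map (T : Symmetry) (L : List Face) (p q : E3) :
    trailLength (L.map T.perm) (T.motion p) (T.motion q) = trailLength L p q := by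
  unfold trailLength
  rw [← T.motion.surjective.iInf_comp]
  refine iInf_congr fun a => ?_
  rw [← T.motion.surjective.iInf_comp]
  refine iInf_congr fun b => ?_
  simp only [T.isCopy_map_iff, T.segment_subset_region_iff,
    LinearIsometryEquiv.edist_map]

theorem surfaceDist_map (T : Symmetry) (p q : E3) :
    surfaceDist (T.motion p) (T.motion q) = surfaceDist p q := by
  have key : ∀ (T : Symmetry) (p q : E3),
      surfaceDist (T.motion p) (T.motion q) ≤ surfaceDist p q := by
    intro T p q
    refine le_iInf₂ fun γ hγ => (iInf₂_le (γ.map T.motion.continuous) fun t => ?_).trans ?_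
    · obtain ⟨F, hF⟩ := Set.mem_iUnion.1 (hγ t)
      exact Set.mem_iUnion.2 ⟨T.perm F, T.mem_face_iff.2 hF⟩
    · have := (T.motion.isometry.lipschitz.lipschitzOnWith (s := Set.univ)).comp_eVariationOn_le
        (g := γ) (s := Set.univ) fun _ _ => Set.mem_univ _
      simpa using this
  refine le_antisymm (key T p q) ?_
  simpa [symm] using key T.symm (T.motion p) (T.motion q)

theorem onLandscape_map_iff (T : Symmetry) {L : List Face} {p : E3} :
    OnLandscape (L.map T.perm) (T.motion p) ↔ OnLandscape L p := by
  simp [OnLandscape, T.mem_face_iff]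

theorem dotProduct_perm (T : Symmetry) (F G : Face) :
    dotProduct (normalZ (T.perm F)) (normalZ (T.perm G)) = dotProduct (normalZ F) (normalZ G) := by
  have := LinearIsometryEquiv.inner_map_map T.motion (normal F) (normal G)
  rw [T.map_normal, T.map_normal, inner_normal_normal, inner_normal_normal] at this
  exact_mod_cast this

theorem adjacent_iff (T : Symmetry) {F G : Face} :
    Adjacent (T.perm F) (T.perm G) ↔ Adjacent F G := by
  unfold Adjacent; rw [T.dotProduct_perm]

/-- The image of a net under a symmetry. -/
noncomputable def mapNet (T : Symmetry) (N : Net) : Net where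
  dual := N.dual.comap T.perm.symm
  isTree := (SimpleGraph.Iso.comap T.perm.symm N.dual).isTree_iff.2 N.isTree
  adjacent F G h := by
    have := N.adjacent _ _ h
    rwa [← T.adjacent_iff, Equiv.apply_symm_apply, Equiv.apply_symm_apply] at this
  base := T.perm N.base
  place F := T.motion ∘ N.place (T.perm.symm F) ∘ T.motion.symm
  place_base := by
    ext x : 1
    simp [N.place_base]
  place_unfold F G h := by
    ext x : 1
    have h2 := T.motion_hinge (T.perm.symm F) (T.perm.symm G) (T.motion.symm x)
    simp only [Equiv.apply_symm_apply, LinearIsometryEquiv.apply_symm_apply] at h2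
    rw [N.place_unfold _ _ h]
    simp [← h2]
  no_overlap F G hFG := by
    have him : ∀ F, (T.motion ∘ N.place (T.perm.symm F) ∘ T.motion.symm) '' faceInterior F
        = T.motion '' (N.place (T.perm.symm F) '' faceInterior (T.perm.symm F)) := by
      intro F
      have : T.motion.symm '' faceInterior F = faceInterior (T.perm.symm F) := by
        ext x
        rw [← T.mem_faceInterior_iff, Equiv.apply_symm_apply, T.motion.symm.image_eq_preimage_symm]
        rfl
      rw [Set.image_comp, Set.image_comp, this]
    rw [him, him]
    exact (Set.disjoint_image_iff T.motion.injective).2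
      (N.no_overlap _ _ (T.perm.symm.injective.ne hFG))

theorem isLandscape_map (T : Symmetry) {L : List Face} (h : IsLandscape L) :
    IsLandscape (L.map T.perm) := by
  obtain ⟨h1, h2, N, h3⟩ := h
  refine ⟨by simpa using h1, h2.map T.perm.injective, T.mapNet N, ?_⟩
  rw [List.isChain_map]
  refine h3.imp fun F G h => ?_
  simpa [mapNet] using h

theorem isLandscape_map_iff (T : Symmetry) {L : List Face} :
    IsLandscape (L.map T.perm) ↔ IsLandscape L := by
  refine ⟨fun h => ?_, T.isLandscape_map⟩
  simpa [symm, Function.comp_def] using T.symm.isLandscape_map h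

theorem witnesses_map (T : Symmetry) {L : List Face} {p q : E3} (h : Witnesses L p q) :
    Witnesses (L.map T.perm) (T.motion p) (T.motion q) := by
  obtain ⟨h1, h2, h3, h4⟩ := h
  refine ⟨T.onLandscape_map_iff.2 h1, T.onLandscape_map_iff.2 h2, ?_, fun K hK hne hp hq hl hs => ?_⟩
  · rw [T.trailLength_map, T.surfaceDist_map, h3]
  · obtain ⟨K, rfl⟩ : ∃ K', K = List.map T.perm K' :=
      ⟨K.map T.perm.symm, by simp [Function.comp_def]⟩
    rw [T.trailLength_map, T.trailLength_map] at hl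
    rw [T.isLandscape_map_iff] at hK
    refine h4 K hK (fun h => hne (h ▸ rfl)) (T.onLandscape_map_iff.1 hp)
      (T.onLandscape_map_iff.1 hq) hl ⟨hK, ?_⟩
    have := hs.2.map T.perm.symm
    simpa [Function.comp_def] using this

theorem isValidLandscape_map (T : Symmetry) {L : List Face} (h : IsValidLandscape L) :
    IsValidLandscape (L.map T.perm) := by
  obtain ⟨h1, p, q, h2⟩ := h
  exact ⟨T.isLandscape_map h1, _, _, T.witnesses_map h2⟩

theorem isValidLandscape_map_iff (T : Symmetry) {L : List Face} :
    IsValidLandscape (L.map T.perm) ↔ IsValidLandscape L := by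
  refine ⟨fun h => ?_, T.isValidLandscape_map⟩
  simpa [symm, Function.comp_def] using T.symm.isValidLandscape_map h

/-- The normals of `F4`, `F5`, `F1` are the standard basis and have orthonormal images, which gives
the motion. Opposite faces are those with dot product `-1`, so `n` commutes with `opp` and the other
three normals follow. -/
theorem exists_of_dotProduct {n : Equiv.Perm Face} (hn : ∀ F G,
    dotProduct (normalZ (n F)) (normalZ (n G)) = dotProduct (normalZ F) (normalZ G)) :
    ∃ T : Symmetry, T.perm = n := by
  let v : Fin 3 → E3 := ![normal (n F4), normal (n F5), normal (n F1)]
  have hv : Orthonormal ℝ v := by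
    rw [orthonormal_iff_ite]
    intro i j
    fin_cases i <;> fin_cases j <;>
      (simp only [v, Fin.mk_zero, Fin.mk_one, Fin.reduceFinMk, Matrix.cons_val]
       rw [inner_normal_normal, hn]
       simp [normalZ])
  let b := (basisOfOrthonormalOfCardEqFinrank hv (by simp)).toOrthonormalBasis
    (by rwa [coe_basisOfOrthonormalOfCardEqFinrank])
  have hb : ∀ i, b i = v i := fun i => by simp [b]
  let T := (EuclideanSpace.basisFun (Fin 3) ℝ).equiv b (Equiv.refl _)
  have hT : ∀ i, T (EuclideanSpace.single i 1) = v i := fun i => by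
    rw [← hb, ← EuclideanSpace.basisFun_apply, OrthonormalBasis.equiv_apply_basis]; rfl
  have h4 : T (normal F4) = normal (n F4) := by
    rw [show normal F4 = EuclideanSpace.single 0 1 from ext_coord (by simp [normal, vec, normalZ])
      (by simp [normal, vec, normalZ]) (by simp [normal, vec, normalZ]), hT]; rfl
  have h5 : T (normal F5) = normal (n F5) := by
    rw [show normal F5 = EuclideanSpace.single 1 1 from ext_coord (by simp [normal, vec, normalZ])
      (by simp [normal, vec, normalZ]) (by simp [normal, vec, normalZ]), hT]; rfl
  have h1 : T (normal F1) = normal (n F1) := by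
    rw [show normal F1 = EuclideanSpace.single 2 1 from ext_coord (by simp [normal, vec, normalZ])
      (by simp [normal, vec, normalZ]) (by simp [normal, vec, normalZ]), hT]; rfl
  have hopp : ∀ F, n (opp F) = opp (n F) := fun F => by
    have h : ∀ F G : Face, dotProduct (normalZ F) (normalZ G) = -1 → G = opp F := by decide
    have h' : ∀ F : Face, dotProduct (normalZ F) (normalZ (opp F)) = -1 := by decide
    exact h _ _ (by rw [hn, h'])
  have hneg : ∀ F, T (normal F) = normal (n F) → T (normal (opp F)) = normal (n (opp F)) :=
    fun F h => by rw [hopp, normal_opp, normal_opp, map_neg, h]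
  exact ⟨⟨n, T, forall_face.2 ⟨h1, hneg F5 h5, hneg F4 h4, h4, h5, hneg F1 h1⟩⟩, rfl⟩

end Symmetry

/-- The permutation of the faces which sends `F1`, `F2`, `F4` and their opposites to `F`, `G`,
`H` and their opposites. -/
def frameMap (F G H : Face) : Face → Face
  | F1 => F | F2 => G | F3 => opp H | F4 => H | F5 => opp G | F6 => opp F

/-- The 48 ordered triples of pairwise adjacent faces give all symmetries of the cube, reflections
included. This allows every geometric computation to be done for `F1`, `F2`, `F4`. -/
theorem exists_symmetry {F G H : Face} (hFG : Adjacent F G) (hFH : Adjacent F H)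
    (hGH : Adjacent G H) : ∃ T : Symmetry, ∀ X, T.perm X = frameMap F G H X := by
  have key : ∀ F G H : Face, Adjacent F G → Adjacent F H → Adjacent G H →
      (∀ X Y, frameMap F G H X = frameMap F G H Y → X = Y) ∧
      ∀ X Y, dotProduct (normalZ (frameMap F G H X)) (normalZ (frameMap F G H Y))
        = dotProduct (normalZ X) (normalZ Y) := by decide
  obtain ⟨hinj, hdot⟩ := key F G H hFG hFH hGH
  obtain ⟨T, hT⟩ := Symmetry.exists_of_dotProduct
    (n := Equiv.ofBijective _ (Finite.injective_iff_bijective.1 fun X Y h => hinj X Y h)) hdot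
  exact ⟨T, fun X => by rw [hT]; rfl⟩


/-! ### Rolling the cube over an unfolded list of faces -/

theorem hinge_hinge {F G : Face} (h : Adjacent F G) (x : E3) : hinge F G (hinge G F x) = x := by
  have h1 := inner_hinge_left h.symm x
  have h2 := inner_hinge_right h.symm x
  rw [hinge, h1, h2, hinge]
  module

theorem develop_surjective : ∀ {L : List Face}, L.IsChain Adjacent → ∀ k,
    Function.Surjective (develop L k)
  | [], _, _ => fun x => ⟨x, rfl⟩
  | [_], _, _ => fun x => ⟨x, rfl⟩
  | _ :: _ :: _, _, 0 => fun x => ⟨x, rfl⟩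
  | F :: G :: L, hL, k + 1 => fun x => by
    rw [List.isChain_cons_cons] at hL
    obtain ⟨y, hy⟩ := develop_surjective hL.2 k (hinge G F x)
    exact ⟨y, by rw [develop_cons_cons_succ, hy, hinge_hinge hL.1]⟩

/-- The position of the cube after rolling: the face on the ground, those facing right and up,
and the square of the plane on which the cube lies. -/
structure Placement where
  bottom : Face
  right : Face
  top : Face
  cx : ℤ
  cy : ℤ

/-- Shift a placement within the plane. -/
def Placement.shift (dx dy : ℤ) (P : Placement) : Placement :=
  { P with cx := dx + P.cx, cy := dy + P.cy }

/-- The cube lies on the first face of the list, with `r` facing right and `t` facing up, and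
rolls over `k` edges of the list. -/
def roll : Face → Face → List Face → ℕ → Placement
  | r, t, f :: g :: L, k + 1 =>
    if g = r then (roll (opp f) t (g :: L) k).shift 1 0
    else if g = opp r then (roll f t (g :: L) k).shift (-1) 0
    else if g = t then (roll r (opp f) (g :: L) k).shift 0 1
    else (roll r f (g :: L) k).shift 0 (-1)
  | r, t, f :: _, _ => ⟨f, r, t, 0, 0⟩
  | r, t, [], _ => ⟨F1, r, t, 0, 0⟩

/-- Three pairwise adjacent faces. -/
def IsFrame (F G H : Face) : Prop := Adjacent F G ∧ Adjacent F H ∧ Adjacent G H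

instance (F G H : Face) : Decidable (IsFrame F G H) := inferInstanceAs (Decidable (_ ∧ _))

theorem mem_face_frame {f r t : Face} (h : IsFrame f r t) {x : E3} : x ∈ face f ↔
    inner ℝ x (normal f) = 1 / 2 ∧ |inner ℝ x (normal r)| ≤ 1 / 2 ∧
      |inner ℝ x (normal t)| ≤ 1 / 2 := by
  have key : ∀ f r t : Face, IsFrame f r t → ∀ G, G = f ∨ G = opp f ∨ G = r ∨ G = opp r ∨
    G = t ∨ G = opp t := by decide
  constructor
  · rintro ⟨h1, h2⟩
    have h3 := h2 (opp r)
    have h4 := h2 (opp t)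
    rw [inner_opp] at h3 h4
    exact ⟨h1, abs_le.2 ⟨by linarith, h2 r⟩, abs_le.2 ⟨by linarith, h2 t⟩⟩
  · rintro ⟨h1, h2, h3⟩
    rw [abs_le] at h2 h3
    refine ⟨h1, fun G => ?_⟩
    rcases key f r t h G with rfl | rfl | rfl | rfl | rfl | rfl <;>
      (try rw [inner_opp]) <;> linarith

/-- Rolling replaces hinges by integer bookkeeping: seen in the frame of the first face, the
unfolded face number `k` is the unit square about the lattice point `(cx, cy)`. -/
theorem roll_spec : ∀ {L : List Face}, L.IsChain Adjacent → ∀ {f r t : Face}, IsFrame f r t →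
    L.head? = some f → ∀ {k : ℕ}, k < L.length →
    L[k]? = some (roll r t L k).bottom ∧
    IsFrame (roll r t L k).bottom (roll r t L k).right (roll r t L k).top ∧
    ∀ x, inner ℝ (develop L k x) (normal f) = inner ℝ x (normal (roll r t L k).bottom) ∧
      inner ℝ (develop L k x) (normal r)
        = (roll r t L k).cx + inner ℝ x (normal (roll r t L k).right) ∧
      inner ℝ (develop L k x) (normal t)
        = (roll r t L k).cy + inner ℝ x (normal (roll r t L k).top)
  | [], _, _, _, _, _, hf, _, _ => by simp at hf
  | [g], _, f, r, t, h, hf, k, hk => by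
    obtain rfl : g = f := by simpa using hf
    obtain rfl : k = 0 := by simpa using hk
    simp [roll, h]
  | g :: g' :: L, _, f, r, t, h, hf, 0, hk => by
    obtain rfl : g = f := by simpa using hf
    simp [roll, h]
  | g :: g' :: L, hL, f, r, t, h, hf, k + 1, hk => by
    obtain rfl : g = f := by simpa using hf
    rw [List.isChain_cons_cons] at hL
    have hk' : k < (g' :: L).length := by simpa using hk
    -- The four directions of rolling; the inequalities follow the order of the tests in `roll`.
    have key : ∀ f r t g : Face, IsFrame f r t → Adjacent f g →
        (g = r ∧ IsFrame r (opp f) t) ∨ (g = opp r ∧ g ≠ r ∧ IsFrame (opp r) f t) ∨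
        (g = t ∧ g ≠ r ∧ g ≠ opp r ∧ IsFrame t r (opp f)) ∨
        (g = opp t ∧ g ≠ r ∧ g ≠ opp r ∧ g ≠ t ∧ IsFrame (opp t) r f) := by decide
    have hco : ∀ f r t : Face, IsFrame f r t → Adjacent (opp r) t ∧ Adjacent (opp t) r := by decide
    rcases key _ _ _ _ h hL.1 with ⟨rfl, h'⟩ | ⟨rfl, h1, h'⟩ | ⟨rfl, h1, h2, h'⟩ | ⟨rfl, h1, h2, h3, h'⟩
    · obtain ⟨i1, i2, i3⟩ := roll_spec hL.2 h' (by simp) hk'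
      simp only [roll, if_true, Placement.shift, develop_cons_cons_succ]
      refine ⟨by simpa using i1, i2, fun x => ?_⟩
      obtain ⟨j1, j2, j3⟩ := i3 x
      rw [inner_hinge_left hL.1, inner_hinge_right hL.1, inner_hinge_other h.2.1 h.2.2, j1, j3]
      rw [inner_opp] at j2
      refine ⟨rfl, ?_, ?_⟩ <;> push_cast <;> linarith
    · obtain ⟨i1, i2, i3⟩ := roll_spec hL.2 h' (by simp) hk'
      simp only [roll, if_neg h1, if_true, Placement.shift, develop_cons_cons_succ]
      refine ⟨by simpa using i1, i2, fun x => ?_⟩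
      obtain ⟨j1, j2, j3⟩ := i3 x
      have := inner_hinge_right hL.1 (develop (opp r :: L) k x)
      rw [inner_opp] at this
      rw [inner_hinge_left hL.1, inner_hinge_other h.2.1 (hco _ _ _ h).1, j1, j3]
      refine ⟨rfl, ?_, ?_⟩ <;> push_cast <;> linarith
    · obtain ⟨i1, i2, i3⟩ := roll_spec hL.2 h' (by simp) hk'
      simp only [roll, if_neg h1, if_neg h2, if_true, Placement.shift, develop_cons_cons_succ]
      refine ⟨by simpa using i1, i2, fun x => ?_⟩
      obtain ⟨j1, j2, j3⟩ := i3 x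
      rw [inner_hinge_left hL.1, inner_hinge_right hL.1, inner_hinge_other h.1 h.2.2.symm, j1, j2]
      rw [inner_opp] at j3
      refine ⟨rfl, ?_, ?_⟩ <;> push_cast <;> linarith
    · obtain ⟨i1, i2, i3⟩ := roll_spec hL.2 h' (by simp) hk'
      simp only [roll, if_neg h1, if_neg h2, if_neg h3, Placement.shift, develop_cons_cons_succ]
      refine ⟨by simpa using i1, i2, fun x => ?_⟩
      obtain ⟨j1, j2, j3⟩ := i3 x
      have := inner_hinge_right hL.1 (develop (opp t :: L) k x)
      rw [inner_opp] at this
      rw [inner_hinge_left hL.1, inner_hinge_other h.1 (hco _ _ _ h).2, j1, j2]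
      refine ⟨rfl, ?_, ?_⟩ <;> push_cast <;> linarith

/-! ### Tiles -/

/-- The unfolded face number `k` of a list of faces. -/
def tile (L : List Face) (k : ℕ) : Set E3 :=
  {a | ∃ F p, L[k]? = some F ∧ p ∈ face F ∧ a = develop L k p}

theorem mem_region_iff {L : List Face} {a : E3} : a ∈ region L ↔ ∃ k < L.length, a ∈ tile L k := by
  constructor
  · rintro ⟨p, k, F, hk, hp, ha⟩
    exact ⟨k, (List.getElem?_eq_some_iff.1 hk).1, F, p, hk, hp, ha⟩
  · rintro ⟨k, -, F, p, hk, hp, ha⟩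
    exact ⟨p, k, F, hk, hp, ha⟩

theorem tile_eq_image {L : List Face} {k : ℕ} {F : Face} (h : L[k]? = some F) :
    tile L k = develop L k '' face F := by
  ext a
  constructor
  · rintro ⟨G, p, hG, hp, ha⟩
    obtain rfl : F = G := by rw [h] at hG; exact Option.some_injective _ hG
    exact ⟨p, hp, ha.symm⟩
  · rintro ⟨p, hp, ha⟩
    exact ⟨F, p, h, hp, ha.symm⟩

theorem isClosed_tile {L : List Face} (hL : L.IsChain Adjacent) {k : ℕ} (hk : k < L.length) :
    IsClosed (tile L k) := by
  obtain ⟨φ, hφ⟩ := exists_affineIsometry_develop hL k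
  rw [tile_eq_image (List.getElem?_eq_getElem hk), ← hφ]
  exact ((isCompact_face _).image φ.continuous).isClosed

theorem convex_tile {L : List Face} (hL : L.IsChain Adjacent) {k : ℕ} (hk : k < L.length) :
    Convex ℝ (tile L k) := by
  obtain ⟨φ, hφ⟩ := exists_affineIsometry_develop hL k
  rw [tile_eq_image (List.getElem?_eq_getElem hk), ← hφ]
  exact (convex_face _).affine_image φ.toAffineMap

theorem mem_tile_iff {L : List Face} (hL : L.IsChain Adjacent) {f r t : Face}
    (h : IsFrame f r t) (hf : L.head? = some f) {k : ℕ} (hk : k < L.length) {a : E3} :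
    a ∈ tile L k ↔ inner ℝ a (normal f) = 1 / 2 ∧
      |inner ℝ a (normal r) - (roll r t L k).cx| ≤ 1 / 2 ∧
      |inner ℝ a (normal t) - (roll r t L k).cy| ≤ 1 / 2 := by
  obtain ⟨h1, h2, h3⟩ := roll_spec hL h hf hk
  rw [tile_eq_image h1]
  obtain ⟨x, rfl⟩ := develop_surjective hL k a
  obtain ⟨φ, hφ⟩ := exists_affineIsometry_develop hL k
  have hinj : Function.Injective (develop L k) := hφ ▸ φ.injective
  rw [hinj.mem_set_image, mem_face_frame h2, (h3 x).1, (h3 x).2.1, (h3 x).2.2,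
    add_sub_cancel_left, add_sub_cancel_left]

/-- The tiles of an unfolded list of faces meet only along the list. -/
def TilesMeetInOrder (L : List Face) : Prop :=
  ∀ k m l, k ≤ m → m ≤ l → l < L.length → tile L k ∩ tile L l ⊆ tile L m

/-- The squares of `P` and `Q` are disjoint, or their intersection lies in the square of `M`. -/
def Placement.Separates (M P Q : Placement) : Prop :=
  2 ≤ |P.cx - Q.cx| ∨ 2 ≤ |P.cy - Q.cy| ∨
    ((M.cx = P.cx ∨ M.cx = Q.cx) ∧ (M.cy = P.cy ∨ M.cy = Q.cy))

instance (M P Q : Placement) : Decidable (M.Separates P Q) := inferInstanceAs (Decidable (_ ∨ _))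

/-- The combinatorial form of `TilesMeetInOrder`. -/
def CellsMeetInOrder (r t : Face) (L : List Face) : Prop :=
  ∀ l < L.length, ∀ m < l + 1, ∀ k < m + 1,
    (roll r t L m).Separates (roll r t L k) (roll r t L l)

instance (r t : Face) (L : List Face) : Decidable (CellsMeetInOrder r t L) :=
  inferInstanceAs (Decidable (∀ l < L.length, ∀ m < l + 1, ∀ k < m + 1, _))

theorem CellsMeetInOrder.tilesMeetInOrder {L : List Face} (hL : L.IsChain Adjacent)
    {f r t : Face} (h : IsFrame f r t) (hf : L.head? = some f) (hc : CellsMeetInOrder r t L) :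
    TilesMeetInOrder L := by
  intro k m l hkm hml hl a ⟨hk, hl'⟩
  rw [mem_tile_iff hL h hf (by omega)] at *
  obtain ⟨h1, h2, h3⟩ := hk
  obtain ⟨-, h4, h5⟩ := hl'
  -- Closed unit intervals about integers at distance at least `2` are disjoint.
  have aux : ∀ {u : ℝ} {c d : ℤ}, |u - c| ≤ 1 / 2 → |u - d| ≤ 1 / 2 → ¬ 2 ≤ |c - d| := by
    intro u c d hc hd hcd
    have : (2 : ℝ) ≤ |(c : ℝ) - d| := by exact_mod_cast hcd
    rw [abs_le] at hc hd
    rcases le_abs.1 this with h | h <;> linarith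
  rcases hc l hl m (by omega) k (by omega) with h | h | ⟨h6, h7⟩
  · exact absurd h (aux h2 h4)
  · exact absurd h (aux h3 h5)
  · refine ⟨h1, ?_, ?_⟩
    · rcases h6 with h | h <;> rwa [h]
    · rcases h7 with h | h <;> rwa [h]

/-! ### Paths of faces, their normal form and their unfoldings -/

/-- A list of at least two distinct faces, any two consecutive ones of which are adjacent. -/
def IsFacePath (L : List Face) : Prop := 2 ≤ L.length ∧ L.Nodup ∧ L.IsChain Adjacent

instance (L : List Face) : Decidable (IsFacePath L) := inferInstanceAs (Decidable (_ ∧ _))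

theorem IsLandscape.isFacePath {L : List Face} (h : IsLandscape L) : IsFacePath L := by
  obtain ⟨h1, h2, N, h3⟩ := h
  exact ⟨h1, h2, h3.imp N.adjacent⟩

theorem IsFacePath.length_le {L : List Face} (h : IsFacePath L) : L.length ≤ 6 :=
  h.2.1.length_le_card

theorem Symmetry.isFacePath_map_iff (T : Symmetry) {L : List Face} :
    IsFacePath (L.map T.perm) ↔ IsFacePath L := by
  unfold IsFacePath
  rw [List.length_map, List.nodup_map_iff T.perm.injective, List.isChain_map]
  simp only [T.adjacent_iff]

theorem Symmetry.tile_map (T : Symmetry) (L : List Face) (k : ℕ) :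
    tile (L.map T.perm) k = T.motion '' tile L k := by
  ext a
  constructor
  · rintro ⟨F, p, hF, hp, rfl⟩
    rw [List.getElem?_map, Option.map_eq_some_iff] at hF
    obtain ⟨G, hG, rfl⟩ := hF
    obtain ⟨p, rfl⟩ := T.motion.surjective p
    exact ⟨_, ⟨G, p, hG, T.mem_face_iff.1 hp, rfl⟩, T.motion_develop _ _ _⟩
  · rintro ⟨_, ⟨F, p, hF, hp, rfl⟩, rfl⟩
    exact ⟨T.perm F, T.motion p, by simp [hF], T.mem_face_iff.2 hp, T.motion_develop _ _ _⟩

theorem Symmetry.tilesMeetInOrder_map (T : Symmetry) {L : List Face} (h : TilesMeetInOrder L) :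
    TilesMeetInOrder (L.map T.perm) := by
  intro k m l hkm hml hl
  rw [T.tile_map, T.tile_map, T.tile_map, ← Set.image_inter T.motion.injective]
  exact Set.image_mono (h k m l hkm hml (by simpa using hl))

/-- Every path of faces can be moved so that it starts with `F1`, `F2`, followed by `F4` or
`F6`, and then not by `F3` directly after `F6`. -/
theorem IsFacePath.exists_map_eq {L : List Face} (h : IsFacePath L) :
    ∃ (T : Symmetry) (L' : List Face), L = L'.map T.perm ∧ IsFacePath L' ∧
      ((∃ R, L' = F1 :: F2 :: R) ∧ (∀ R, L' ≠ F1 :: F2 :: F3 :: R) ∧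
        (∀ R, L' ≠ F1 :: F2 :: F6 :: F3 :: R)) := by
  obtain ⟨F, G, R, rfl⟩ : ∃ F G R, L = F :: G :: R := by
    match L, h.1 with
    | F :: G :: R, _ => exact ⟨F, G, R, rfl⟩
  have hFG : Adjacent F G := (List.isChain_cons_cons.1 h.2.2).1
  -- `opp H` will play the role of `F3`. The two candidates for `H` are opposite to each other, so
  -- one of them avoids any given `X`.
  have key : ∀ F G X : Face, Adjacent F G → ∃ H, IsFrame F G H ∧ X ≠ opp H := by decide
  have key' : ∀ F G H : Face, IsFrame F G H → opp F ≠ opp H := by decide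
  have reduce : ∀ H, IsFrame F G H → (∀ S, R ≠ opp H :: S) → (∀ S, R ≠ opp F :: opp H :: S) →
      ∃ (T : Symmetry) (L' : List Face), F :: G :: R = L'.map T.perm ∧ IsFacePath L' ∧
        ((∃ R, L' = F1 :: F2 :: R) ∧ (∀ R, L' ≠ F1 :: F2 :: F3 :: R) ∧
        (∀ R, L' ≠ F1 :: F2 :: F6 :: F3 :: R)) := by
    intro H hH h1 h2
    obtain ⟨T, hT⟩ := exists_symmetry hH.1 hH.2.1 hH.2.2
    have hL' : F :: G :: R = (F1 :: F2 :: R.map T.perm.symm).map T.perm := by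
      have h1 : T.perm F1 = F := hT F1
      have h2 : T.perm F2 = G := hT F2
      simp [h1, h2]
    rw [hL', T.isFacePath_map_iff] at h
    refine ⟨T, _, hL', h, ⟨_, rfl⟩, fun S hS => ?_, fun S hS => ?_⟩
    · rw [hS] at hL'
      exact h1 (S.map T.perm) (by simpa [hT, frameMap] using hL')
    · rw [hS] at hL'
      exact h2 (S.map T.perm) (by simpa [hT, frameMap] using hL')
  match R with
  | [] =>
    obtain ⟨H, hH, -⟩ := key F G F hFG
    exact reduce H hH (by simp) (by simp)
  | X :: R' =>
    by_cases hX : X = opp F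
    · match R' with
      | [] =>
        obtain ⟨H, hH, -⟩ := key F G F hFG
        exact reduce H hH (by simp [hX, key' F G H hH]) (by simp)
      | Y :: R'' =>
        obtain ⟨H, hH, hY⟩ := key F G Y hFG
        exact reduce H hH (by simp [hX, key' F G H hH]) (by simp [hY])
    · obtain ⟨H, hH, hXH⟩ := key F G X hFG
      exact reduce H hH (by simp [hXH]) (by simp [hX])

/-- In normal form there are finitely many paths, of at most six faces, and their lattice cells can
be inspected. Only adjacency of consecutive faces enters, not the net from which a landscape comes.
-/
theorem IsFacePath.tilesMeetInOrder {L : List Face} (h : IsFacePath L) : TilesMeetInOrder L := by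
  obtain ⟨T, L, rfl, h', ⟨R, rfl⟩, -⟩ := h.exists_map_eq
  refine T.tilesMeetInOrder_map ?_
  have hlen := h'.length_le
  refine CellsMeetInOrder.tilesMeetInOrder (f := F1) (r := F2) (t := F4) h'.2.2 (by decide) rfl ?_
  match R, h', hlen with
  | [], _, _ => decide
  | [X], h, _ => clear * - h; revert X; decide
  | [X, Y], h, _ => clear * - h; revert X Y; decide
  | [X, Y, Z], h, _ => clear * - h; revert X Y Z; decide +kernel
  | [X, Y, Z, W], h, _ => clear * - h; revert X Y Z W; decide +kernel


/-! ### Trails -/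

/-- `a` is the copy of `p` in the unfolded face number `k` of `L`. -/
def CopyAt (L : List Face) (k : ℕ) (p a : E3) : Prop :=
  ∃ F, L[k]? = some F ∧ p ∈ face F ∧ a = develop L k p

theorem CopyAt.lt {L : List Face} {k : ℕ} {p a : E3} (h : CopyAt L k p a) : k < L.length := by
  obtain ⟨F, hF, -⟩ := h
  exact (List.getElem?_eq_some_iff.1 hF).1

theorem CopyAt.mem_tile {L : List Face} {k : ℕ} {p a : E3} (h : CopyAt L k p a) :
    a ∈ tile L k := by
  obtain ⟨F, hF, hp, rfl⟩ := h
  exact ⟨F, p, hF, hp, rfl⟩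

theorem CopyAt.edist_eq {L : List Face} (hL : IsFacePath L) {k : ℕ} {p q a b : E3}
    (hp : CopyAt L k p a) (hq : CopyAt L k q b) : edist a b = edist p q := by
  obtain ⟨_, _, _, rfl⟩ := hp
  obtain ⟨_, _, _, rfl⟩ := hq
  rw [edist_dist, dist_develop hL.2.2, edist_dist]

theorem CopyAt.surfaceDist_le {L : List Face} {k : ℕ} {p q a b : E3}
    (hp : CopyAt L k p a) (hq : CopyAt L k q b) : surfaceDist p q ≤ edist p q := by
  obtain ⟨F, hF, hp, -⟩ := hp
  obtain ⟨G, hG, hq, -⟩ := hq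
  obtain rfl : F = G := Option.some_injective _ (hF.symm.trans hG)
  exact surfaceDist_le_edist hp hq

theorem edist_add_edist_of_mem_segment {a b x : E3} (h : x ∈ segment ℝ a b) :
    edist a x + edist x b = edist a b := by
  rw [edist_dist, edist_dist, edist_dist, ← ENNReal.ofReal_add dist_nonneg dist_nonneg,
    dist_add_dist_of_mem_segment h]

theorem segment_subset_union {a b x : E3} (hx : x ∈ segment ℝ a b) :
    segment ℝ a b ⊆ segment ℝ a x ∪ segment ℝ x b := by
  rw [segment_eq_image_lineMap] at hx
  obtain ⟨t, ht, rfl⟩ := hx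
  intro z hz
  rw [segment_eq_image_lineMap] at hz
  obtain ⟨s, hs, rfl⟩ := hz
  rcases le_total s t with hst | hst
  · have := image_segment ℝ (AffineMap.lineMap a b : ℝ →ᵃ[ℝ] E3) 0 t
    rw [AffineMap.lineMap_apply_zero, segment_eq_Icc ht.1] at this
    exact Or.inl (this ▸ ⟨s, ⟨hs.1, hst⟩, rfl⟩)
  · have := image_segment ℝ (AffineMap.lineMap a b : ℝ →ᵃ[ℝ] E3) t 1
    rw [AffineMap.lineMap_apply_one, segment_eq_Icc ht.2] at this
    exact Or.inr (this ▸ ⟨s, ⟨hst, hs.2⟩, rfl⟩)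

/-- A segment in the unfolded landscape crosses the common edges of consecutive faces. -/
theorem exists_crossing {L : List Face} (hL : IsFacePath L) {a b p q : E3}
    (hab : segment ℝ a b ⊆ region L) {i j k : ℕ} (ha : CopyAt L i p a) (hb : CopyAt L j q b)
    (hik : i ≤ k) (hkj : k < j) :
    ∃ x ∈ segment ℝ a b, ∃ y, CopyAt L k y x ∧ CopyAt L (k + 1) y x := by
  have hj := hb.lt
  have hA : IsClosed (⋃ m ∈ Set.Iic k, tile L m) :=
    (Set.finite_Iic k).isClosed_biUnion fun m hm =>
      isClosed_tile hL.2.2 (lt_of_le_of_lt hm (hkj.trans hj))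
  have hB : IsClosed (⋃ m ∈ Set.Ioo k L.length, tile L m) :=
    (Set.finite_Ioo k L.length).isClosed_biUnion fun m hm => isClosed_tile hL.2.2 hm.2
  -- The tiles up to `k` and the tiles after `k` form two closed sets that cover the connected
  -- segment, so a point of it lies in both. By the order of the tiles this point then lies in the
  -- tiles `k` and `k + 1`.
  have hcon := isPreconnected_closed_iff.1 (convex_segment (𝕜 := ℝ) a b).isPreconnected _ _ hA hB
    (fun z hz => by
      obtain ⟨m, hm, hzm⟩ := mem_region_iff.1 (hab hz)
      rcases le_or_gt m k with h | h
      · exact Or.inl (Set.mem_biUnion (Set.mem_Iic.2 h) hzm)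
      · exact Or.inr (Set.mem_biUnion (Set.mem_Ioo.2 ⟨h, hm⟩) hzm))
    ⟨a, left_mem_segment ℝ a b, Set.mem_biUnion (Set.mem_Iic.2 hik) ha.mem_tile⟩
    ⟨b, right_mem_segment ℝ a b, Set.mem_biUnion (Set.mem_Ioo.2 ⟨hkj, hj⟩) hb.mem_tile⟩
  obtain ⟨x, hx, hxA, hxB⟩ := hcon
  simp only [Set.mem_iUnion, Set.mem_Iic, Set.mem_Ioo, exists_prop] at hxA hxB
  obtain ⟨m, hm, hxm⟩ := hxA
  obtain ⟨l, hl, hxl⟩ := hxB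
  obtain ⟨F, y, hF, hy, rfl⟩ := hL.tilesMeetInOrder m k l hm hl.1.le hl.2 ⟨hxm, hxl⟩
  obtain ⟨G, z, hG, hz, hyz⟩ := hL.tilesMeetInOrder m (k + 1) l (hm.trans k.le_succ) hl.1 hl.2
    ⟨hxm, hxl⟩
  obtain rfl := eq_of_develop_eq_develop_succ hL.2.2 hF hG hy hz hyz
  exact ⟨_, hx, y, ⟨F, hF, hy, rfl⟩, ⟨G, hG, hz, hyz⟩⟩

/-- A segment in the unfolded landscape runs through the faces between its ends only, and it is
at least as long as the surface distance. -/
theorem segment_subset_and_surfaceDist_le {L : List Face} (hL : IsFacePath L) {a b p q : E3}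
    (hab : segment ℝ a b ⊆ region L) {i j : ℕ} (ha : CopyAt L i p a) (hb : CopyAt L j q b)
    (hij : i ≤ j) :
    (∀ x ∈ segment ℝ a b, ∃ m, i ≤ m ∧ m ≤ j ∧ x ∈ tile L m) ∧ surfaceDist p q ≤ edist a b := by
  obtain ⟨d, rfl⟩ := Nat.exists_eq_add_of_le hij
  induction d generalizing i a p with
  | zero =>
    refine ⟨fun x hx => ⟨i, le_rfl, hij,
      (convex_tile hL.2.2 ha.lt).segment_subset ha.mem_tile hb.mem_tile hx⟩, ?_⟩
    rw [ha.edist_eq hL hb]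
    exact ha.surfaceDist_le hb
  | succ d ih =>
    -- The piece up to the first crossing stays in the convex tile `i`; the remaining piece starts
    -- in tile `i + 1`.
    obtain ⟨x, hx, y, hy, hy'⟩ := exists_crossing hL hab ha hb le_rfl (by omega)
    rw [show i + (d + 1) = i + 1 + d by omega] at hb
    have hxb : segment ℝ x b ⊆ segment ℝ a b :=
      (convex_segment a b).segment_subset hx (right_mem_segment ℝ a b)
    obtain ⟨h1, h2⟩ := ih (hxb.trans hab) hy' hb (by omega)
    constructor
    · intro z hz
      have hz' : z ∈ segment ℝ a x ∪ segment ℝ x b :=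
        segment_subset_union hx hz
      rcases hz' with hz | hz
      · exact ⟨i, le_rfl, hij, (convex_tile hL.2.2 ha.lt).segment_subset ha.mem_tile hy.mem_tile hz⟩
      · obtain ⟨m, hm, hm', hzm⟩ := h1 z hz
        exact ⟨m, by omega, by omega, hzm⟩
    · calc surfaceDist p q ≤ surfaceDist p y + surfaceDist y q := surfaceDist_triangle _ _ _
        _ ≤ edist a x + edist x b := by
          refine add_le_add ?_ h2
          rw [ha.edist_eq hL hy]
          exact ha.surfaceDist_le hy
        _ = edist a b := edist_add_edist_of_mem_segment hx

theorem surfaceDist_le_trailLength {L : List Face} (hL : IsFacePath L) (p q : E3) :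
    surfaceDist p q ≤ trailLength L p q := by
  refine le_iInf₂ fun a b => le_iInf₂ fun ⟨i, ha⟩ ⟨j, hb⟩ => le_iInf fun hab => ?_
  rcases le_total i j with hij | hij
  · exact (segment_subset_and_surfaceDist_le hL hab ha hb hij).2
  · rw [surfaceDist_comm, edist_comm]
    exact (segment_subset_and_surfaceDist_le hL (segment_symm ℝ a b ▸ hab) hb ha hij).2

theorem trailLength_le {L : List Face} {a b p q : E3} (ha : IsCopy L p a) (hb : IsCopy L q b)
    (hab : segment ℝ a b ⊆ region L) : trailLength L p q ≤ edist a b :=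
  iInf₂_le_of_le a b (iInf₂_le_of_le ha hb (iInf_le _ hab))

theorem trailLength_comm (L : List Face) (p q : E3) : trailLength L p q = trailLength L q p := by
  have key : ∀ p q : E3, trailLength L p q ≤ trailLength L q p := fun p q =>
    le_iInf₂ fun a b => le_iInf₂ fun ha hb => le_iInf fun hab =>
      edist_comm a b ▸ trailLength_le hb ha (segment_symm ℝ a b ▸ hab)
  exact le_antisymm (key p q) (key q p)

/-- A finite trail length is attained. -/
theorem exists_trail {L : List Face} {p q : E3} (h : trailLength L p q ≠ ⊤) :
    ∃ a b i j, CopyAt L i p a ∧ CopyAt L j q b ∧ segment ℝ a b ⊆ region L ∧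
      edist a b = trailLength L p q := by
  -- A point has at most one copy per face, so the infimum runs over finitely many pairs of copies.
  have hfin : ∀ p, {a | IsCopy L p a}.Finite := fun p => by
    refine ((Set.finite_Iio L.length).image fun k => develop L k p).subset ?_
    rintro a ⟨k, hk⟩
    exact ⟨k, CopyAt.lt hk, hk.choose_spec.2.2.symm⟩
  let S : Set (E3 × E3) := {w | (IsCopy L p w.1 ∧ IsCopy L q w.2) ∧ segment ℝ w.1 w.2 ⊆ region L}
  have hS : S.Finite := ((hfin p).prod (hfin q)).subset fun w hw => ⟨hw.1.1, hw.1.2⟩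
  have heq : trailLength L p q = ⨅ w : S, edist w.1.1 w.1.2 := by
    refine le_antisymm (le_iInf fun w => trailLength_le w.2.1.1 w.2.1.2 w.2.2) ?_
    exact le_iInf₂ fun a b => le_iInf₂ fun ha hb => le_iInf fun hab =>
      iInf_le (fun w : S => edist w.1.1 w.1.2) ⟨(a, b), ⟨ha, hb⟩, hab⟩
  have hne : Nonempty S := by
    by_contra hemp
    rw [not_nonempty_iff] at hemp
    exact h (by rw [heq, iInf_of_empty])
  have := hS.to_subtype
  obtain ⟨⟨⟨a, b⟩, ⟨⟨i, ha⟩, j, hb⟩, hab⟩, hw⟩ :=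
    exists_eq_ciInf_of_finite (f := fun w : S => edist w.1.1 w.1.2)
  exact ⟨a, b, i, j, ha, hb, hab, hw.trans heq.symm⟩

/-- A point of a shortest trail divides it into shortest trails. -/
theorem exists_crossing_of_shortest {L : List Face} (hL : IsFacePath L) {a b p q : E3}
    (hab : segment ℝ a b ⊆ region L) {i j k : ℕ} (ha : CopyAt L i p a) (hb : CopyAt L j q b)
    (hd : edist a b = surfaceDist p q) (hik : i ≤ k) (hkj : k < j) :
    ∃ x y, CopyAt L k y x ∧ CopyAt L (k + 1) y x ∧ edist a x = surfaceDist p y ∧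
      edist x b = surfaceDist y q := by
  obtain ⟨x, hx, y, hy, hy'⟩ := exists_crossing hL hab ha hb hik hkj
  have hseg : ∀ u v, u ∈ segment ℝ a b → v ∈ segment ℝ a b → segment ℝ u v ⊆ region L :=
    fun u v hu hv => ((convex_segment a b).segment_subset hu hv).trans hab
  have h1 := (segment_subset_and_surfaceDist_le hL
    (hseg a x (left_mem_segment ℝ a b) hx) ha hy hik).2
  have h2 := (segment_subset_and_surfaceDist_le hL
    (hseg x b hx (right_mem_segment ℝ a b)) hy' hb hkj).2
  have h3 := edist_add_edist_of_mem_segment hx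
  have h4 := surfaceDist_triangle p y q
  rw [← hd, ← h3] at h4
  -- Both pieces are at least as long as the distances they realise, and by the triangle inequality
  -- their sum is at most the sum of these. Being finite, the lengths can be cancelled.
  have hax : edist a x ≠ ⊤ := edist_ne_top _ _
  have hxb : edist x b ≠ ⊤ := edist_ne_top _ _
  refine ⟨x, y, hy, hy', le_antisymm ?_ h1, le_antisymm ?_ h2⟩
  · exact (ENNReal.add_le_add_iff_right hxb).1 (h4.trans (by gcongr))
  · exact (ENNReal.add_le_add_iff_left hax).1 (h4.trans (by gcongr))

/-! ### Shortening landscapes at an end -/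

theorem copyAt_tail {F G : Face} {R : List Face} {k : ℕ} {p a : E3}
    (h : CopyAt (F :: G :: R) (k + 1) p a) :
    ∃ a', CopyAt (G :: R) k p a' ∧ a = hinge F G a' := by
  obtain ⟨H, hH, hp, rfl⟩ := h
  exact ⟨_, ⟨H, by simpa using hH, hp, rfl⟩, rfl⟩

theorem CopyAt.cons {F G : Face} {R : List Face} {k : ℕ} {p a : E3}
    (h : CopyAt (G :: R) k p a) : CopyAt (F :: G :: R) (k + 1) p (hinge F G a) := by
  obtain ⟨H, hH, hp, rfl⟩ := h
  exact ⟨H, by simpa using hH, hp, rfl⟩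

theorem develop_append : ∀ (L R : List Face) {k : ℕ} (_ : k < L.length) (x : E3),
    develop (L ++ R) k x = develop L k x
  | [], _, _, hk, _ => by simp at hk
  | [F], R, k, hk, x => by
    obtain rfl : k = 0 := by simpa using hk
    simp
  | F :: G :: L, R, 0, _, x => by simp
  | F :: G :: L, R, k + 1, hk, x => by
    have := develop_append (G :: L) R (k := k) (by simpa using hk) x
    simp only [List.cons_append, develop_cons_cons_succ] at this ⊢
    rw [this]

theorem copyAt_append_iff {L R : List Face} {k : ℕ} (hk : k < L.length) {p a : E3} :
    CopyAt (L ++ R) k p a ↔ CopyAt L k p a := by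
  unfold CopyAt
  rw [List.getElem?_append_left hk]
  simp only [develop_append L R hk]

theorem hinge_image_segment {F G : Face} (h : Adjacent F G) (a b : E3) :
    hinge F G '' segment ℝ a b = segment ℝ (hinge F G a) (hinge F G b) := by
  obtain ⟨φ, hφ⟩ := exists_affineIsometry_hinge h
  rw [← hφ]
  exact image_segment ℝ φ.toAffineMap a b

/-- A face added in front moves the old unfolding by a hinge, an isometry, and only enlarges the
region. -/
theorem trailLength_le_tail {F G : Face} {R : List Face} (h : Adjacent F G) (p q : E3) :
    trailLength (F :: G :: R) p q ≤ trailLength (G :: R) p q := by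
  refine le_iInf₂ fun a b => le_iInf₂ fun ⟨i, ha⟩ ⟨j, hb⟩ => le_iInf fun hab => ?_
  have hd : edist (hinge F G a) (hinge F G b) = edist a b := by
    rw [edist_dist, dist_hinge h, edist_dist]
  rw [← hd]
  refine trailLength_le ⟨_, CopyAt.cons ha⟩ ⟨_, CopyAt.cons hb⟩ ?_
  rw [← hinge_image_segment h]
  rintro _ ⟨x, hx, rfl⟩
  obtain ⟨y, k, hy⟩ := hab hx
  exact ⟨y, _, CopyAt.cons hy⟩

theorem trailLength_le_append (L R : List Face) (p q : E3) :
    trailLength (L ++ R) p q ≤ trailLength L p q := by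
  have hcopy : ∀ {p a}, IsCopy L p a → IsCopy (L ++ R) p a := fun ⟨k, h⟩ =>
    ⟨k, (copyAt_append_iff (CopyAt.lt h)).2 h⟩
  exact le_iInf₂ fun a b => le_iInf₂ fun ha hb => le_iInf fun hab =>
    trailLength_le (hcopy ha) (hcopy hb) fun x hx => (hab hx).imp fun _ => hcopy

theorem IsLandscape.of_infix {K L : List Face} (hL : IsLandscape L) (h : K <:+: L)
    (hK : 2 ≤ K.length) : IsLandscape K := by
  obtain ⟨-, h2, N, h3⟩ := hL
  exact ⟨hK, h2.sublist h.sublist, N, h3.infix h⟩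

theorem CopyAt.onLandscape {L : List Face} {k : ℕ} {p a : E3} (h : CopyAt L k p a) :
    OnLandscape L p := by
  obtain ⟨F, hF, hp, -⟩ := h
  exact ⟨F, List.mem_of_getElem? hF, hp⟩

/-- A trail that does not start in the first face of the landscape does not need this face. -/
theorem not_witnesses_of_tail {F G : Face} {R : List Face} (hL : IsLandscape (F :: G :: R))
    (hR : R ≠ []) {a b p q : E3} (hab : segment ℝ a b ⊆ region (F :: G :: R)) {i j : ℕ}
    (ha : CopyAt (F :: G :: R) (i + 1) p a) (hb : CopyAt (F :: G :: R) (j + 1) q b) (hij : i ≤ j)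
    (hd : edist a b = trailLength (F :: G :: R) p q) : ¬ Witnesses (F :: G :: R) p q := by
  rintro ⟨-, -, -, h⟩
  have hadj : Adjacent F G := (List.isChain_cons_cons.1 hL.isFacePath.2.2).1
  have hinf : G :: R <:+: F :: G :: R := (List.suffix_cons F _).isInfix
  -- The trail stays in tiles with positive index, hence it is also a trail of `G :: R`, of the same
  -- length.
  have hsub := (segment_subset_and_surfaceDist_le hL.isFacePath hab ha hb (by omega)).1
  obtain ⟨a', ha', rfl⟩ := copyAt_tail ha
  obtain ⟨b', hb', rfl⟩ := copyAt_tail hb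
  have hK : IsLandscape (G :: R) := hL.of_infix hinf (by
    have := List.length_pos_iff.2 hR
    simp only [List.length_cons]; omega)
  refine h (G :: R) hK (by simp) ha'.onLandscape hb'.onLandscape
    (le_antisymm (trailLength_le_tail hadj p q) ?_) ⟨hK, hinf⟩
  rw [← hd, edist_dist, dist_hinge hadj, ← edist_dist]
  refine trailLength_le ⟨_, ha'⟩ ⟨_, hb'⟩ fun x hx => ?_
  have hx' : hinge F G x ∈ segment ℝ (hinge F G a') (hinge F G b') :=
    hinge_image_segment hadj a' b' ▸ ⟨x, hx, rfl⟩
  obtain ⟨m, hm, -, H, y, hy⟩ := hsub _ hx'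
  obtain ⟨m, rfl⟩ : ∃ m', m = m' + 1 := ⟨m - 1, by omega⟩
  obtain ⟨z, hz, hxz⟩ := copyAt_tail ⟨H, hy⟩
  obtain ⟨φ, hφ⟩ := exists_affineIsometry_hinge hadj
  rw [← hφ] at hxz
  exact φ.injective hxz ▸ ⟨y, m, hz⟩

/-- A trail that does not end in the last face of the landscape does not need this face. -/
theorem not_witnesses_of_append {L : List Face} {F : Face} (hL : IsLandscape (L ++ [F]))
    (hlen : 2 ≤ L.length) {a b p q : E3} (hab : segment ℝ a b ⊆ region (L ++ [F])) {i j : ℕ}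
    (ha : CopyAt (L ++ [F]) i p a) (hb : CopyAt (L ++ [F]) j q b) (hij : i ≤ j)
    (hj : j < L.length)
    (hd : edist a b = trailLength (L ++ [F]) p q) : ¬ Witnesses (L ++ [F]) p q := by
  rintro ⟨-, -, -, h⟩
  have hinf : L <:+: L ++ [F] := (List.prefix_append L _).isInfix
  have hsub := (segment_subset_and_surfaceDist_le hL.isFacePath hab ha hb hij).1
  rw [copyAt_append_iff (by omega)] at ha hb
  have hK : IsLandscape L := hL.of_infix hinf hlen
  refine h L hK (by simp) ha.onLandscape hb.onLandscape
    (le_antisymm (trailLength_le_append L [F] p q) ?_) ⟨hK, hinf⟩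
  rw [← hd]
  refine trailLength_le ⟨_, ha⟩ ⟨_, hb⟩ fun x hx => ?_
  obtain ⟨m, -, hm, H, y, hy⟩ := hsub _ hx
  exact ⟨y, m, (copyAt_append_iff (by omega)).1 ⟨H, hy⟩⟩


/-! ### Upper bounds for the surface distance -/

@[simp] theorem normal_apply (F : Face) (i : Fin 3) : normal F i = (normalZ F i : ℝ) := rfl

theorem edist_le_edist_iff {a b c d : E3} : edist a b ≤ edist c d ↔
    (a 0 - b 0) ^ 2 + (a 1 - b 1) ^ 2 + (a 2 - b 2) ^ 2
      ≤ (c 0 - d 0) ^ 2 + (c 1 - d 1) ^ 2 + (c 2 - d 2) ^ 2 := by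
  rw [edist_dist, edist_dist, ENNReal.ofReal_le_ofReal_iff dist_nonneg,
    ← sq_le_sq₀ dist_nonneg dist_nonneg, sq_dist, sq_dist]

theorem edist_hinge {F G : Face} (h : Adjacent F G) (x y : E3) :
    edist (hinge F G x) (hinge F G y) = edist x y := by
  rw [edist_dist, dist_hinge h, edist_dist]

theorem surfaceDist_le_hinge_of_mem_segment {F G : Face} (h : Adjacent F G) {p q b x : E3}
    (hp : p ∈ face F) (hxF : x ∈ face F) (hxG : x ∈ face G)
    (hx : x ∈ segment ℝ p (hinge F G b)) (hq : surfaceDist x q ≤ edist x b) :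
    surfaceDist p q ≤ edist p (hinge F G b) := by
  rw [← edist_add_edist_of_mem_segment hx]
  refine (surfaceDist_triangle p x q).trans (add_le_add (surfaceDist_le_edist hp hxF) ?_)
  have := edist_hinge h x b
  rw [hinge_eq_self hxF.1 hxG.1] at this
  rwa [this]

/-- The point in which the segment from `p` to `b` crosses the line of the edge between `F1` and
`F2`. -/
theorem exists_mem_segment_crossing {p b : E3} (hp : p ∈ face F1) (hb : b 1 ≤ -(1 / 2))
    (hb2 : b 2 = 1 / 2) :
    ∃ x ∈ segment ℝ p b, ∃ τ : ℝ, 0 ≤ τ ∧ τ ≤ 1 ∧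
      τ * (p 1 - b 1) = p 1 + 1 / 2 ∧ x 0 = p 0 + τ * (b 0 - p 0) ∧ x 1 = -(1 / 2) ∧
        x 2 = 1 / 2 := by
  obtain ⟨hp2, -, ⟨-, hp1⟩, -⟩ := mem_face.1 hp
  rw [inner_F1] at hp2
  obtain ⟨τ, h0, h1, hτ⟩ : ∃ τ : ℝ, 0 ≤ τ ∧ τ ≤ 1 ∧ τ * (p 1 - b 1) = p 1 + 1 / 2 := by
    rcases (show 0 ≤ p 1 - b 1 by linarith).eq_or_lt with h | h
    · exact ⟨0, le_rfl, zero_le_one, by linarith⟩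
    · exact ⟨(p 1 + 1 / 2) / (p 1 - b 1), div_nonneg (by linarith) h.le,
        (div_le_one h).2 (by linarith), div_mul_cancel₀ _ h.ne'⟩
  refine ⟨AffineMap.lineMap p b τ, ?_, τ, h0, h1, hτ, ?_, ?_, ?_⟩
  · rw [segment_eq_image_lineMap]; exact ⟨τ, ⟨h0, h1⟩, rfl⟩
  · simp [AffineMap.lineMap_apply]; ring
  · simp [AffineMap.lineMap_apply]; linarith
  · simp [AffineMap.lineMap_apply, hb2, hp2]

/-- The two squares unfold to a rectangle; as it is convex, the segment crosses the line of the edge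
within the edge. -/
theorem surfaceDist_le_hinge {F G : Face} (h : Adjacent F G) {p q : E3}
    (hp : p ∈ face F) (hq : q ∈ face G) : surfaceDist p q ≤ edist p (hinge F G q) := by
  obtain ⟨H, hH⟩ : ∃ H, IsFrame F G H := by
    have key : ∀ F G : Face, Adjacent F G → ∃ H, IsFrame F G H := by decide
    exact key F G h
  obtain ⟨T, hT⟩ := exists_symmetry hH.1 hH.2.1 hH.2.2
  obtain ⟨p, rfl⟩ := T.motion.surjective p
  obtain ⟨q, rfl⟩ := T.motion.surjective q
  obtain rfl : T.perm F1 = F := hT F1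
  obtain rfl : T.perm F2 = G := hT F2
  rw [T.mem_face_iff] at hp hq
  rw [T.surfaceDist_map, ← T.motion_hinge, LinearIsometryEquiv.edist_map]
  have hq' := mem_face.1 hq
  have hp' := mem_face.1 hp
  have c0 : hinge F1 F2 q 0 = q 0 := by simp [hinge, normalZ]
  have c1 : hinge F1 F2 q 1 = q 2 - 1 := by simp [hinge, normalZ]
  have c2 : hinge F1 F2 q 2 = -q 1 := by simp [hinge, normalZ]
  simp only [inner_F1, inner_F2] at hp' hq'
  obtain ⟨x, hx, τ, h0, h1, hτ, hx0, hx1, hx2⟩ := exists_mem_segment_crossing hp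
    (b := hinge F1 F2 q) (by linarith) (by linarith)
  rw [c0] at hx0
  have hx0' : x 0 ≤ 1 / 2 ∧ -(1 / 2) ≤ x 0 := by
    constructor <;> nlinarith
  have hxF1 : x ∈ face F1 := mem_face.2 ⟨by simp [hx2], hx0', by norm_num [hx1], by norm_num [hx2]⟩
  have hxF2 : x ∈ face F2 := mem_face.2 ⟨by simp [hx1], hx0', by norm_num [hx1], by norm_num [hx2]⟩
  exact surfaceDist_le_hinge_of_mem_segment (by decide) hp hxF1 hxF2 hx
    (surfaceDist_le_edist hxF2 hq)

/-- Any two faces have a common neighbour, and a path through its centre has finite length. -/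
theorem surfaceDist_ne_top {F G : Face} {p q : E3} (hp : p ∈ face F) (hq : q ∈ face G) :
    surfaceDist p q ≠ ⊤ := by
  have key : ∀ F G : Face, ∃ H, Adjacent F H ∧ Adjacent H G := by decide
  obtain ⟨H, hF, hG⟩ := key F G
  have hr : (1 / 2 : ℝ) • normal H ∈ face H := by
    rw [mem_face]
    cases H <;> simp [normalZ]
  refine ne_top_of_le_ne_top ?_ (surfaceDist_triangle p ((1 / 2 : ℝ) • normal H) q)
  exact ENNReal.add_ne_top.2
    ⟨ne_top_of_le_ne_top (edist_ne_top _ _) (surfaceDist_le_hinge hF hp hr),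
      ne_top_of_le_ne_top (edist_ne_top _ _) (surfaceDist_le_hinge hG hr hq)⟩

/-- The surface distance of points of adjacent faces is at most their distance in the unfolding
around a common corner, even if the segment joining them leaves this unfolding. -/
theorem surfaceDist_le_corner {F G H : Face} (hH : IsFrame F G H) {p q : E3}
    (hp : p ∈ face F) (hq : q ∈ face H) :
    surfaceDist p q ≤ edist p (hinge F G (hinge G H q)) := by
  obtain ⟨T, hT⟩ := exists_symmetry hH.1 hH.2.1 hH.2.2
  obtain ⟨p, rfl⟩ := T.motion.surjective p
  obtain ⟨q, rfl⟩ := T.motion.surjective q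
  obtain rfl : T.perm F1 = F := hT F1
  obtain rfl : T.perm F2 = G := hT F2
  obtain rfl : T.perm F4 = H := hT F4
  rw [T.mem_face_iff] at hp hq
  rw [T.surfaceDist_map, ← T.motion_hinge, ← T.motion_hinge, LinearIsometryEquiv.edist_map]
  have hq' := mem_face.1 hq
  have hp' := mem_face.1 hp
  have c0 : hinge F1 F2 (hinge F2 F4 q) 0 = 1 + q 1 := by simp [hinge, normalZ]
  have c1 : hinge F1 F2 (hinge F2 F4 q) 1 = q 2 - 1 := by simp [hinge, normalZ]; ring
  have c2 : hinge F1 F2 (hinge F2 F4 q) 2 = q 0 := by simp [hinge, normalZ]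
  have d0 : hinge F1 F4 q 0 = 1 - q 2 := by simp [hinge, normalZ]
  have d1 : hinge F1 F4 q 1 = q 1 := by simp [hinge, normalZ]
  have d2 : hinge F1 F4 q 2 = q 0 := by simp [hinge, normalZ]
  simp only [inner_F1, inner_F4] at hp' hq'
  obtain ⟨x, hx, τ, h0, h1, hτ, hx0, hx1, hx2⟩ := exists_mem_segment_crossing hp
    (b := hinge F1 F2 (hinge F2 F4 q)) (by linarith) (by linarith)
  rw [c0] at hx0
  rw [c1] at hτ
  rcases le_or_gt (x 0) (1 / 2) with hle | hlt
  · have hx0' : x 0 ≤ 1 / 2 ∧ -(1 / 2) ≤ x 0 := ⟨hle, by nlinarith⟩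
    have hxF1 : x ∈ face F1 :=
      mem_face.2 ⟨by simp [hx2], hx0', by norm_num [hx1], by norm_num [hx2]⟩
    have hxF2 : x ∈ face F2 :=
      mem_face.2 ⟨by simp [hx1], hx0', by norm_num [hx1], by norm_num [hx2]⟩
    exact surfaceDist_le_hinge_of_mem_segment (by decide) hp hxF1 hxF2 hx
      (surfaceDist_le_hinge (by decide) hxF2 hq)
  -- The segment passes the vertex on the outer side. Attaching `F4` directly to `F1` turns the copy
  -- of `q` by a quarter turn about this vertex, which here brings it no farther from `p`.
  · refine (surfaceDist_le_hinge (by decide) hp hq).trans (edist_le_edist_iff.2 ?_)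
    rw [c0, c1, c2, d0, d1, d2]
    have hpos : 0 ≤ p 1 - (q 2 - 1) := by linarith
    have : (1 / 2 - p 0) * (p 1 - (q 2 - 1)) ≤ (p 1 + 1 / 2) * (1 + q 1 - p 0) := by
      rw [← hτ]; nlinarith
    nlinarith

/-! ### Shortest trails in long landscapes -/

section windows

variable {p q : E3}

/-- The routes by `F2`, `F6` and directly from `F1` to `F5` go round the same belt of circumference
`4` in opposite directions, with equal sideways displacement. The first covers at least `2` of it,
with equality only if `p` is on the edge of `F2` and `q` on that of `F6`. -/
theorem mem_of_straight (hp : p ∈ face F1) (hq : q ∈ face F5)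
    (h : edist p (hinge F1 F2 (hinge F2 F6 (hinge F6 F5 q))) = surfaceDist p q) :
    p ∈ face F2 := by
  have h' := edist_le_edist_iff.1 (h.trans_le (surfaceDist_le_hinge (by decide) hp hq))
  have hp' := mem_face.1 hp
  have hq' := mem_face.1 hq
  simp [hinge, normalZ] at h' hp' hq'
  refine ⟨?_, hp.2⟩
  simp
  nlinarith

/-- Going from `F2` directly to `F4` turns the copy of `q` by a quarter turn about the vertex of
`F2`, `F4`, `F6`. With this vertex as origin, `p = (-a, b)` and `q = (u, -v)` becomes `(v, u)`,
where `u`, `v`, `a` are in `[0, 1]` and `b` in `[1, 2]`. The squared lengths differ by `2 * (u * (a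
+ b) + v * (b - a))`, so equality forces `u = 0`, and for `v = 1` also `a = b = 1`. -/
theorem of_hook (hp : p ∈ face F1) (hq : q ∈ face F4)
    (h : edist p (hinge F1 F2 (hinge F2 F6 (hinge F6 F4 q))) = surfaceDist p q) :
    q ∈ face F6 ∧ (q ∈ face F5 → p ∈ face F2) := by
  have h' := edist_le_edist_iff.1
    (h.trans_le (surfaceDist_le_corner (G := F2) (by decide) hp hq))
  have hp' := mem_face.1 hp
  have hq' := mem_face.1 hq
  simp [hinge, normalZ] at h' hp' hq'
  refine ⟨⟨?_, hq.2⟩, fun h5 => ⟨?_, hp.2⟩⟩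
  · simp
    nlinarith
  · have h5' := (mem_face.1 h5).1
    simp at h5' ⊢
    nlinarith

/-- A hook read backwards: the comparison is with the route `F1`, `F4`, `F5`, which avoids the
detour by `F2`. -/
theorem mem_of_reverse_hook (hp : p ∈ face F1) (hq : q ∈ face F5)
    (h : edist p (hinge F1 F2 (hinge F2 F4 (hinge F4 F5 q))) = surfaceDist p q) :
    p ∈ face F2 := by
  have h' := edist_le_edist_iff.1
    (h.trans_le (surfaceDist_le_corner (G := F4) (by decide) hp hq))
  have hp' := mem_face.1 hp
  have hq' := mem_face.1 hq
  simp [hinge, normalZ] at h' hp' hq'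
  refine ⟨?_, hp.2⟩
  simp
  nlinarith

/-- The route `F1`, `F4`, `F5` avoids both the detour by `F2` and that by `F6`. -/
theorem mem_of_stairs (hp : p ∈ face F1) (hq : q ∈ face F5)
    (h : edist p (hinge F1 F2 (hinge F2 F4 (hinge F4 F6 (hinge F6 F5 q)))) = surfaceDist p q) :
    p ∈ face F2 := by
  have h' := edist_le_edist_iff.1
    (h.trans_le (surfaceDist_le_corner (G := F4) (by decide) hp hq))
  have hp' := mem_face.1 hp
  have hq' := mem_face.1 hq
  simp [hinge, normalZ] at h' hp' hq'
  refine ⟨?_, hp.2⟩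
  simp
  nlinarith

/-- As `p` is on the edge of `F2`, the route may start in `F2`, and `F2`, `F6`, `F3` avoids `F4`. -/
theorem mem_of_corner_hook (hp : p ∈ face F1) (hp2 : p ∈ face F2) (hq : q ∈ face F3)
    (h : edist p (hinge F1 F2 (hinge F2 F4 (hinge F4 F6 (hinge F6 F3 q)))) = surfaceDist p q) :
    q ∈ face F6 := by
  have h' := edist_le_edist_iff.1
    (h.trans_le (surfaceDist_le_corner (G := F6) (by decide) hp2 hq))
  have hp' := mem_face.1 hp
  have hp2' := mem_face.1 hp2
  have hq' := mem_face.1 hq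
  simp [hinge, normalZ] at h' hp' hp2' hq'
  refine ⟨?_, hq.2⟩
  simp
  nlinarith

/-- As `p` is on the edge of `F4`, the route may start in `F4`, and `F4`, `F6`, `F5` avoids `F3`. -/
theorem mem_of_corner_stairs (hp : p ∈ face F2) (hp2 : p ∈ face F4) (hq : q ∈ face F5)
    (h : edist (hinge F1 F2 p)
      (hinge F1 F2 (hinge F2 F4 (hinge F4 F6 (hinge F6 F3 (hinge F3 F5 q))))) = surfaceDist p q) :
    q ∈ face F3 := by
  rw [edist_hinge (by decide)] at h
  have h' := edist_le_edist_iff.1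
    (h.trans_le (surfaceDist_le_corner (G := F6) (by decide) hp2 hq))
  have hp' := mem_face.1 hp
  have hp2' := mem_face.1 hp2
  have hq' := mem_face.1 hq
  simp [hinge, normalZ] at h' hp' hp2' hq'
  refine ⟨?_, hq.2⟩
  simp
  nlinarith

end windows


/-! ### Excluding landscapes by their full trails -/

theorem Witnesses.symm {L : List Face} {p q : E3} (h : Witnesses L p q) : Witnesses L q p := by
  obtain ⟨h1, h2, h3, h4⟩ := h
  refine ⟨h2, h1, by rw [trailLength_comm, h3, surfaceDist_comm], fun K hK hne hq hp hl => ?_⟩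
  exact h4 K hK hne hp hq (by rwa [trailLength_comm L, trailLength_comm K])

theorem not_witnesses_of_ends {L : List Face} (hL : IsLandscape L) (hlen : 3 ≤ L.length)
    {a b p q : E3} (hab : segment ℝ a b ⊆ region L) {i j : ℕ} (ha : CopyAt L i p a)
    (hb : CopyAt L j q b) (hij : i ≤ j) (hor : i ≠ 0 ∨ j ≠ L.length - 1)
    (hd : edist a b = trailLength L p q) : ¬ Witnesses L p q := by
  rcases hor with h0 | h0
  · obtain ⟨F, G, R, rfl⟩ : ∃ F G R, L = F :: G :: R := by
      rcases L with _ | ⟨F, _ | ⟨G, R⟩⟩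
      · simp at hlen
      · simp at hlen
      · exact ⟨F, G, R, rfl⟩
    have hR : R ≠ [] := by
      rintro rfl
      simp at hlen
    obtain ⟨i, rfl⟩ := Nat.exists_eq_add_one_of_ne_zero h0
    obtain ⟨j, rfl⟩ := Nat.exists_eq_add_one_of_ne_zero (n := j) (by omega)
    exact not_witnesses_of_tail hL hR hab ha hb (by omega) hd
  · have hj := hb.lt
    obtain ⟨K, F, rfl⟩ : ∃ K F, L = K ++ [F] :=
      ⟨_, _, (List.dropLast_append_getLast (List.ne_nil_of_length_pos (by omega))).symm⟩
    simp only [List.length_append, List.length_singleton] at hlen h0 hj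
    exact not_witnesses_of_append hL (by omega) hab ha hb hij (by omega) hd

/-- `a`, `b` are the ends of a shortest trail from `p` to `q` which runs through all of `L`. -/
structure IsFullTrail (L : List Face) (p q a b : E3) : Prop where
  segment_subset : segment ℝ a b ⊆ region L
  left : CopyAt L 0 p a
  right : CopyAt L (L.length - 1) q b
  edist_eq : edist a b = surfaceDist p q

/-- If every shortest trail through all of `L` has an end in the common edge of two consecutive
faces, then `L` is not valid. -/
theorem not_isValidLandscape_of_ends {L : List Face} (hlen : 3 ≤ L.length)
    (h : ∀ p q a b, IsFullTrail L p q a b →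
      CopyAt L 1 p a ∨ CopyAt L (L.length - 2) q b) : ¬ IsValidLandscape L := by
  rintro ⟨hL, p, q, hw⟩
  -- The trail length is finite and so attained by some pair of copies; exchanging `p` and `q` puts
  -- them in the order of the list.
  wlog hij : ∃ a b i j, i ≤ j ∧ CopyAt L i p a ∧ CopyAt L j q b ∧ segment ℝ a b ⊆ region L ∧
      edist a b = trailLength L p q generalizing p q
  · have hfin : trailLength L p q ≠ ⊤ := by
      intro htop
      obtain ⟨⟨F, hF, hp⟩, ⟨G, hG, hq⟩, hd, -⟩ := hw
      rw [htop] at hd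
      obtain ⟨k, hk⟩ := List.mem_iff_getElem?.1 hF
      obtain ⟨l, hl⟩ := List.mem_iff_getElem?.1 hG
      exact absurd hd.symm (surfaceDist_ne_top hp hq)
    obtain ⟨a, b, i, j, ha, hb, hab, hd⟩ := exists_trail hfin
    rcases le_total i j with hle | hle
    · exact hij ⟨a, b, i, j, hle, ha, hb, hab, hd⟩
    · refine this q p hw.symm ⟨b, a, j, i, hle, hb, ha, segment_symm ℝ a b ▸ hab, ?_⟩
      rw [edist_comm, trailLength_comm, hd]
  obtain ⟨a, b, i, j, hij, ha, hb, hab, hd⟩ := hij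
  have hends : ∀ i j, i ≤ j → CopyAt L i p a → CopyAt L j q b →
      ¬ (i ≠ 0 ∨ j ≠ L.length - 1) :=
    fun i j hij ha hb hor => not_witnesses_of_ends hL hlen hab ha hb hij hor hd hw
  by_cases hor : i ≠ 0 ∨ j ≠ L.length - 1
  · exact hends i j hij ha hb hor
  · push Not at hor
    obtain ⟨rfl, rfl⟩ := hor
    rcases h p q a b ⟨hab, ha, hb, hd.trans hw.2.2.1⟩ with h1 | h1
    · exact hends 1 _ (by omega) h1 hb (Or.inl one_ne_zero)
    · exact hends 0 _ (by omega) ha h1 (Or.inr (by omega))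

theorem IsFullTrail.left_eq {L : List Face} {p q a b : E3} (h : IsFullTrail L p q a b) :
    a = p := by
  obtain ⟨F, -, -, h⟩ := h.left
  rw [h, develop_zero]

theorem IsFullTrail.mem_left {F : Face} {L : List Face} {p q a b : E3}
    (h : IsFullTrail (F :: L) p q a b) : p ∈ face F := by
  obtain ⟨G, hG, hp, -⟩ := h.left
  simp at hG
  exact hG ▸ hp

theorem IsFullTrail.copyAt_one {F G : Face} {R : List Face} {p q a b : E3}
    (h : IsFullTrail (F :: G :: R) p q a b) (hp : p ∈ face G) : CopyAt (F :: G :: R) 1 p a := by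
  refine ⟨G, rfl, hp, ?_⟩
  rw [h.left_eq, develop_eq_develop_succ (k := 0) rfl rfl h.mem_left hp, develop_zero]

/-- The part of a full trail up to the face number `k`. -/
theorem IsFullTrail.exists_prefix {L : List Face} (hL : IsFacePath L) {p q a b : E3}
    (h : IsFullTrail L p q a b) {k : ℕ} {F : Face} (hF : L[k]? = some F) :
    ∃ y ∈ face F, edist p (develop L k y) = surfaceDist p y ∧
      ∀ G, L[k + 1]? = some G → y ∈ face G := by
  have hk := (List.getElem?_eq_some_iff.1 hF).1
  rcases (show k ≤ L.length - 1 by omega).eq_or_lt with rfl | hlt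
  · obtain ⟨G, hG, hq, rfl⟩ := h.right
    obtain rfl : F = G := Option.some_injective _ (hF.symm.trans hG)
    refine ⟨q, hq, h.left_eq ▸ h.edist_eq, fun G hG => ?_⟩
    have := (List.getElem?_eq_some_iff.1 hG).1
    omega
  · obtain ⟨x, y, ⟨F', hF', hy, rfl⟩, ⟨G, hG, hy', -⟩, hd, -⟩ :=
      exists_crossing_of_shortest hL h.segment_subset h.left h.right h.edist_eq (Nat.zero_le k) hlt
    obtain rfl : F = F' := Option.some_injective _ (hF.symm.trans hF')
    refine ⟨y, hy, h.left_eq ▸ hd, fun G' hG' => ?_⟩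
    obtain rfl : G = G' := Option.some_injective _ (hG.symm.trans hG')
    exact hy'

/-- The part of a full trail from the common edge of the faces number `k` and `k + 1`. -/
theorem IsFullTrail.exists_suffix {L : List Face} (hL : IsFacePath L) {p q a b : E3}
    (h : IsFullTrail L p q a b) {k : ℕ} {F G : Face} (hF : L[k]? = some F)
    (hG : L[k + 1]? = some G) :
    ∃ y ∈ face F, y ∈ face G ∧ edist (develop L k y) (develop L (L.length - 1) q)
      = surfaceDist y q := by
  have hk := (List.getElem?_eq_some_iff.1 hG).1
  obtain ⟨x, y, ⟨F', hF', hy, rfl⟩, ⟨G', hG', hy', -⟩, -, hd⟩ :=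
    exists_crossing_of_shortest hL h.segment_subset h.left h.right h.edist_eq (Nat.zero_le k)
      (by omega)
  obtain rfl : F = F' := Option.some_injective _ (hF.symm.trans hF')
  obtain rfl : G = G' := Option.some_injective _ (hG.symm.trans hG')
  obtain ⟨_, _, _, rfl⟩ := h.right
  exact ⟨y, hy, hy', hd⟩

theorem copyAt_penultimate {L : List Face} {F : Face} {q b : E3} (hlen : 2 ≤ L.length)
    (hF : L[L.length - 2]? = some F)
    (hb : CopyAt L (L.length - 1) q b) (hq : q ∈ face F) : CopyAt L (L.length - 2) q b := by
  obtain ⟨G', hG', hq', rfl⟩ := hb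
  refine ⟨F, hF, hq, ?_⟩
  rw [show L.length - 1 = L.length - 2 + 1 by omega] at hG' ⊢
  exact develop_eq_develop_succ hF hG' hq hq'

/-- After the four valid shapes, the cases are sorted by the window that will exclude them. A tail
`S` is left open where the initial faces suffice for this. -/
theorem length_le_three_or_eq_of_isFacePath {L : List Face} (h : IsFacePath L)
    (h2 : ∃ R, L = F1 :: F2 :: R) (h3 : ∀ R, L ≠ F1 :: F2 :: F3 :: R)
    (h4 : ∀ R, L ≠ F1 :: F2 :: F6 :: F3 :: R) :
    L = [F1, F2] ∨ L = [F1, F2, F4] ∨ L = [F1, F2, F6] ∨ L = [F1, F2, F4, F6] ∨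
    (∃ S, L = F1 :: F2 :: F6 :: F5 :: S) ∨ L = [F1, F2, F6, F4] ∨
    (∃ S, L = F1 :: F2 :: F6 :: F4 :: F5 :: S) ∨ (∃ S, L = F1 :: F2 :: F4 :: F5 :: S) ∨
    (∃ S, L = F1 :: F2 :: F4 :: F6 :: F5 :: S) ∨ L = [F1, F2, F4, F6, F3] ∨
    L = [F1, F2, F4, F6, F3, F5] := by
  obtain ⟨R, rfl⟩ := h2
  have hlen := h.length_le
  match R, h, h3, h4, hlen with
  | [], _, _, _, _ => simp
  | [X], h, h3, h4, _ =>
    have key : ∀ X, IsFacePath [F1, F2, X] → X = F3 ∨ X = F4 ∨ X = F6 := by decide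
    rcases key X h with rfl | rfl | rfl <;> simp at h3 h4 ⊢
  | [X, Y], h, h3, h4, _ =>
    have key : ∀ X Y, IsFacePath [F1, F2, X, Y] → X = F3 ∨ X = F4 ∧ (Y = F5 ∨ Y = F6) ∨
      X = F6 ∧ (Y = F3 ∨ Y = F4 ∨ Y = F5) := by decide
    rcases key X Y h with rfl | ⟨rfl, rfl | rfl⟩ | ⟨rfl, rfl | rfl | rfl⟩ <;> simp at h3 h4 ⊢
  | [X, Y, Z], h, h3, h4, _ =>
    have key : ∀ X Y Z, IsFacePath [F1, F2, X, Y, Z] → X = F3 ∨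
      X = F4 ∧ (Y = F5 ∨ Y = F6 ∧ (Z = F5 ∨ Z = F3)) ∨
      X = F6 ∧ (Y = F3 ∨ Y = F4 ∧ Z = F5 ∨ Y = F5) := by decide +kernel
    rcases key X Y Z h with rfl | ⟨rfl, rfl | ⟨rfl, rfl | rfl⟩⟩ |
      ⟨rfl, rfl | ⟨rfl, rfl⟩ | rfl⟩ <;> simp at h3 h4 ⊢
  | [X, Y, Z, W], h, h3, h4, _ =>
    have key : ∀ X Y Z W, IsFacePath [F1, F2, X, Y, Z, W] → X = F3 ∨
      X = F4 ∧ (Y = F5 ∨ Y = F6 ∧ (Z = F5 ∨ Z = F3 ∧ W = F5)) ∨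
      X = F6 ∧ (Y = F3 ∨ Y = F4 ∧ Z = F5 ∨ Y = F5) := by decide +kernel
    rcases key X Y Z W h with rfl | ⟨rfl, rfl | ⟨rfl, rfl | ⟨rfl, rfl⟩⟩⟩ |
      ⟨rfl, rfl | ⟨rfl, rfl⟩ | rfl⟩ <;> simp at h3 h4 ⊢

/-- Pieces of a shortest trail are shortest. In each of the seven other cases the piece in the
window shows that the whole trail starts on its first edge or ends on its last one. -/
theorem eq_of_isValidLandscape_of_normal {L : List Face} (hv : IsValidLandscape L)
    (h2 : ∃ R, L = F1 :: F2 :: R) (h3 : ∀ R, L ≠ F1 :: F2 :: F3 :: R)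
    (h4 : ∀ R, L ≠ F1 :: F2 :: F6 :: F3 :: R) :
    L = [F1, F2] ∨ L = [F1, F2, F4] ∨ L = [F1, F2, F6] ∨ L = [F1, F2, F4, F6] := by
  have hL := hv.1.isFacePath
  rcases length_le_three_or_eq_of_isFacePath hL h2 h3 h4 with h | h | h | h | ⟨S, rfl⟩ | rfl |
    ⟨S, rfl⟩ | ⟨S, rfl⟩ | ⟨S, rfl⟩ | rfl | rfl
  · exact Or.inl h
  · exact Or.inr (Or.inl h)
  · exact Or.inr (Or.inr (Or.inl h))
  · exact Or.inr (Or.inr (Or.inr h))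
  all_goals
    refine absurd hv (not_isValidLandscape_of_ends (by simp) fun p q a b h => ?_)
  · obtain ⟨y, hy, hd, -⟩ := h.exists_prefix hL (k := 3) rfl
    exact Or.inl (h.copyAt_one (mem_of_straight h.mem_left hy (by simpa using hd)))
  · obtain ⟨F, hF, hq, rfl⟩ := h.right
    obtain rfl : F4 = F := by simpa using hF
    refine Or.inr (copyAt_penultimate (by simp) rfl h.right ?_)
    have hd := h.edist_eq
    rw [h.left_eq] at hd
    exact (of_hook h.mem_left hq (by simpa using hd)).1
  -- The trail leaves `F4` through the edge of `F5`, so the second part of `of_hook` applies and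
  -- moves the start instead of the end.
  · obtain ⟨y, hy, hd, hy'⟩ := h.exists_prefix hL (k := 3) rfl
    exact Or.inl (h.copyAt_one ((of_hook h.mem_left hy (by simpa using hd)).2 (hy' _ rfl)))
  · obtain ⟨y, hy, hd, -⟩ := h.exists_prefix hL (k := 3) rfl
    exact Or.inl (h.copyAt_one (mem_of_reverse_hook h.mem_left hy (by simpa using hd)))
  · obtain ⟨y, hy, hd, -⟩ := h.exists_prefix hL (k := 4) rfl
    exact Or.inl (h.copyAt_one (mem_of_stairs h.mem_left hy (by simpa using hd)))
  -- In the last two cases the window starts where the trail crosses an edge, so that its start may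
  -- be read in the next face.
  · obtain ⟨y, hy, hy', hd⟩ := h.exists_suffix hL (k := 0) rfl rfl
    obtain ⟨F, hF, hq, -⟩ := h.right
    obtain rfl : F3 = F := by simpa using hF
    exact Or.inr (copyAt_penultimate (by simp) rfl h.right
      (mem_of_corner_hook hy hy' hq (by simpa using hd)))
  · obtain ⟨y, hy, hy', hd⟩ := h.exists_suffix hL (k := 1) rfl rfl
    obtain ⟨F, hF, hq, -⟩ := h.right
    obtain rfl : F5 = F := by simpa using hF
    exact Or.inr (copyAt_penultimate (by simp) rfl h.right
      (mem_of_corner_stairs hy hy' hq (by simpa using hd)))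


/-! ### A net -/

/-- The position of a face on a path through all faces. -/
def netIndex : Face → ℕ
  | F5 => 0 | F1 => 1 | F2 => 2 | F3 => 3 | F6 => 4 | F4 => 5

/-- The path `F5`, `F1`, `F2`, `F3`, `F6`, `F4` of faces. -/
def netGraph : SimpleGraph Face where
  Adj F G := netIndex F + 1 = netIndex G ∨ netIndex G + 1 = netIndex F
  symm := ⟨fun _ _ h => h.symm⟩
  loopless := ⟨fun F h => by rcases h with h | h <;> omega⟩

instance : DecidableRel netGraph.Adj := fun F G =>
  inferInstanceAs (Decidable (netIndex F + 1 = netIndex G ∨ netIndex G + 1 = netIndex F))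

/-- The motions which unfold the cube along `netGraph` into the plane of `F1`. -/
noncomputable def netPlace : Face → E3 → E3
  | F1 => id
  | F5 => hinge F1 F5
  | F2 => hinge F1 F2
  | F3 => hinge F1 F2 ∘ hinge F2 F3
  | F6 => hinge F1 F2 ∘ hinge F2 F3 ∘ hinge F3 F6
  | F4 => hinge F1 F2 ∘ hinge F2 F3 ∘ hinge F3 F6 ∘ hinge F6 F4

/-- The centre of the unfolded face. -/
def netCentre : Face → ℤ × ℤ
  | F1 => (0, 0) | F5 => (0, 1) | F2 => (0, -1) | F3 => (-1, -1) | F6 => (-1, -2) | F4 => (-1, -3)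

theorem mem_faceInterior {F : Face} {x : E3} : x ∈ faceInterior F ↔
    inner ℝ x (normal F) = 1 / 2 ∧ (F1 ≠ F → x 2 < 1 / 2) ∧ (F2 ≠ F → -x 1 < 1 / 2) ∧
      (F3 ≠ F → -x 0 < 1 / 2) ∧ (F4 ≠ F → x 0 < 1 / 2) ∧ (F5 ≠ F → x 1 < 1 / 2) ∧
      (F6 ≠ F → -x 2 < 1 / 2) := by
  simp only [faceInterior, Set.mem_ofPred_eq, forall_face, inner_F1, inner_F2, inner_F3, inner_F4,
    inner_F5, inner_F6]

/-- The faces unfold to unit squares about distinct lattice points; this is why the net does not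
overlap. -/
theorem abs_netPlace_sub_lt {F : Face} {x : E3} (hx : x ∈ faceInterior F) :
    |netPlace F x 0 - (netCentre F).1| < 1 / 2 ∧ |netPlace F x 1 - (netCentre F).2| < 1 / 2 := by
  rw [mem_faceInterior] at hx
  cases F <;> simp [netPlace, netCentre, hinge, normalZ, abs_lt] at hx ⊢ <;>
    refine ⟨⟨?_, ?_⟩, ?_, ?_⟩ <;> linarith

/-- A net of the cube. -/
noncomputable def pathNet : Net where
  dual := netGraph
  isTree := by
    have h1 : netGraph.Connected := by decide
    have h2 : netGraph.edgeFinset.card = 5 := by decide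
    rw [SimpleGraph.isTree_iff_connected_and_card]
    refine ⟨h1, ?_⟩
    rw [← SimpleGraph.coe_edgeFinset, Nat.card_coe_set_eq, Set.ncard_coe_finset, h2]
    rw [Nat.card_eq_fintype_card]
    rfl
  adjacent := by
    have h : ∀ F G : Face, netGraph.Adj F G → Adjacent F G := by decide
    exact h
  base := F1
  place := netPlace
  place_base := rfl
  place_unfold F G h := by
    have hh : ∀ F G : Face, Adjacent F G → hinge F G ∘ hinge G F = id := fun F G h =>
      funext fun x => hinge_hinge h x
    cases F <;> cases G <;> first
      | (exact absurd h (by decide))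
      | rfl
      | (simp only [netPlace, Function.comp_assoc]; rw [hh _ _ (by decide)]; try rfl)
  no_overlap F G hFG := by
    rw [Set.disjoint_left]
    rintro _ ⟨x, hx, rfl⟩ ⟨y, hy, hxy⟩
    have h1 := abs_netPlace_sub_lt hx
    have h2 := abs_netPlace_sub_lt hy
    rw [hxy] at h2
    have aux : ∀ {u : ℝ} {c d : ℤ}, |u - c| < 1 / 2 → |u - d| < 1 / 2 → c = d := by
      intro u c d hc hd
      rw [abs_lt] at hc hd
      have h1 : (c : ℝ) < d + 1 := by linarith
      have h2 : (d : ℝ) < c + 1 := by linarith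
      have h1' : c < d + 1 := by exact_mod_cast h1
      have h2' : d < c + 1 := by exact_mod_cast h2
      omega
    have hinj : ∀ F G : Face, netCentre F = netCentre G → F = G := by decide
    exact hFG (hinj F G (Prod.ext (aux h1.1 h2.1) (aux h1.2 h2.2)))

/-! ### Witnesses -/

/-- An interior point lies in one face only. A sublandscape with both points thus contains the first
and the last face of `L`, and as no face repeats, it is `L`. -/
theorem witnesses_of_interior {F G : Face} {L : List Face} (hL : IsLandscape L)
    (hF : L.head? = some F) (hG : L.getLast? = some G) {p q : E3} (hp : p ∈ faceInterior F)
    (hp' : p ∈ face F) (hq : q ∈ faceInterior G) (hq' : q ∈ face G)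
    (hseg : segment ℝ p (develop L (L.length - 1) q) ⊆ region L)
    (hd : edist p (develop L (L.length - 1) q) ≤ surfaceDist p q) : Witnesses L p q := by
  have huniq : ∀ {F G : Face} {p : E3}, p ∈ faceInterior F → p ∈ face G → G = F :=
    fun hp hpG => by_contra fun hne => (hp.2 _ hne).ne hpG.1
  have hp0 : CopyAt L 0 p p := ⟨F, by rw [← List.head?_eq_getElem?, hF], hp', by simp⟩
  have hq0 : CopyAt L (L.length - 1) q (develop L (L.length - 1) q) :=
    ⟨G, by rw [← List.getLast?_eq_getElem?, hG], hq', rfl⟩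
  refine ⟨hp0.onLandscape, hq0.onLandscape, le_antisymm
    ((trailLength_le ⟨_, hp0⟩ ⟨_, hq0⟩ hseg).trans hd)
    (surfaceDist_le_trailLength hL.isFacePath p q), ?_⟩
  rintro K hK hne ⟨F', hF', hpK⟩ ⟨G', hG', hqK⟩ - ⟨-, s, t, rfl⟩
  rw [huniq hp hpK] at hF'
  rw [huniq hq hqK] at hG'
  have hnd := hL.2.1
  refine hne ?_
  have hs : s = [] := by
    rcases s with _ | ⟨X, s⟩
    · rfl
    · obtain rfl : X = F := by simpa using hF
      simp [hF'] at hnd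
  have ht : t = [] := by
    rcases List.eq_nil_or_concat t with rfl | ⟨t, X, rfl⟩
    · rfl
    · obtain rfl : X = G := by simpa [← List.append_assoc] using hG
      simp only [List.concat_eq_append, List.nodup_append] at hnd
      exact absurd rfl (hnd.2.2 X (by simp [hG']) X (by simp))
  simp [hs, ht]

/-- `le_surfaceDist_of_discs` in terms of squares. -/
theorem edist_le_surfaceDist_of_discs {R : ℝ} (hR : 0 ≤ R) {A B : Face → List E3}
    (hA : ∀ F G x, x ∈ face F → x ∈ face G → ∀ a ∈ A F,
      (x 0 - a 0) ^ 2 + (x 1 - a 1) ^ 2 + (x 2 - a 2) ^ 2 < R → ∃ b ∈ A G,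
        (x 0 - b 0) ^ 2 + (x 1 - b 1) ^ 2 + (x 2 - b 2) ^ 2
          ≤ (x 0 - a 0) ^ 2 + (x 1 - a 1) ^ 2 + (x 2 - a 2) ^ 2)
    (hB : ∀ F G x, x ∈ face F → x ∈ face G → ∀ a ∈ B F,
      (x 0 - a 0) ^ 2 + (x 1 - a 1) ^ 2 + (x 2 - a 2) ^ 2 < R → ∃ b ∈ B G,
        (x 0 - b 0) ^ 2 + (x 1 - b 1) ^ 2 + (x 2 - b 2) ^ 2
          ≤ (x 0 - a 0) ^ 2 + (x 1 - a 1) ^ 2 + (x 2 - a 2) ^ 2)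
    (hAB : ∀ F, ∀ a ∈ A F, ∀ b ∈ B F,
      4 * R ≤ (a 0 - b 0) ^ 2 + (a 1 - b 1) ^ 2 + (a 2 - b 2) ^ 2)
    {F G : Face} {p q : E3} (hp : p ∈ face F) (hq : q ∈ face G) (hpA : p ∈ A F) (hqB : q ∈ B G)
    {b : E3} (hb : (p 0 - b 0) ^ 2 + (p 1 - b 1) ^ 2 + (p 2 - b 2) ^ 2 ≤ 4 * R) :
    edist p b ≤ surfaceDist p q := by
  have hr := Real.sqrt_nonneg R
  have key : ∀ A : Face → List E3, (∀ F G x, x ∈ face F → x ∈ face G → ∀ a ∈ A F,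
      (x 0 - a 0) ^ 2 + (x 1 - a 1) ^ 2 + (x 2 - a 2) ^ 2 < R → ∃ b ∈ A G,
        (x 0 - b 0) ^ 2 + (x 1 - b 1) ^ 2 + (x 2 - b 2) ^ 2
          ≤ (x 0 - a 0) ^ 2 + (x 1 - a 1) ^ 2 + (x 2 - a 2) ^ 2) →
      ∀ F G x, x ∈ face F → x ∈ face G → ∀ a ∈ A F, dist x a < √R →
        ∃ b ∈ A G, dist x b ≤ dist x a := by
    intro A hA F G x hF hG a ha hlt
    rw [Real.lt_sqrt dist_nonneg, sq_dist] at hlt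
    obtain ⟨b, hb, hle⟩ := hA F G x hF hG a ha hlt
    exact ⟨b, hb, by rwa [← sq_le_sq₀ dist_nonneg dist_nonneg, sq_dist, sq_dist]⟩
  refine le_trans ?_ (le_surfaceDist_of_discs hr (key A hA) (key B hB) (fun F a ha b hb => ?_)
    hp hq hpA hqB)
  · rw [edist_dist]
    refine ENNReal.ofReal_le_ofReal ?_
    rw [← sq_le_sq₀ dist_nonneg (by positivity), sq_dist, mul_pow, Real.sq_sqrt hR]
    linarith
  · rw [← sq_le_sq₀ (by positivity) dist_nonneg, sq_dist, mul_pow, Real.sq_sqrt hR]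
    linarith [hAB F a ha b hb]


/-- This one path contains all four shapes: `F1, F2` (edge), `F1, F2, F3` (corner), `F5, F1, F2`
(straight) and `F1, F2, F3, F6` (zigzag). -/
theorem isLandscape_of_infix_path {L : List Face} (h : 2 ≤ L.length)
    (hL : L <:+: [F5, F1, F2, F3, F6, F4]) : IsLandscape L :=
  IsLandscape.of_infix (L := [F5, F1, F2, F3, F6, F4])
    ⟨by decide, by decide, pathNet, by change List.IsChain netGraph.Adj _; decide⟩ hL h

/-! ### The discs about the witnessing points -/

/-- The images of a point in the planes of the faces are consistent for discs with squared radius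
`R`: on the edge of two faces the images for one of them are not needed, if those for the other
are known. -/
def Consistent (R : ℝ) (A : Face → List E3) : Prop :=
  ∀ F G x, x ∈ face F → x ∈ face G → ∀ a ∈ A F,
    (x 0 - a 0) ^ 2 + (x 1 - a 1) ^ 2 + (x 2 - a 2) ^ 2 < R → ∃ b ∈ A G,
      (x 0 - b 0) ^ 2 + (x 1 - b 1) ^ 2 + (x 2 - b 2) ^ 2
        ≤ (x 0 - a 0) ^ 2 + (x 1 - a 1) ^ 2 + (x 2 - a 2) ^ 2

/-- The images of `(0, -3/10, 1/2)` for a small disc. -/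
noncomputable def edgeImages : Face → List E3
  | F1 => [!₂[0, -(3 / 10), 1 / 2]]
  | _ => []

/-- The open disc of radius `1 / 5` just fails to reach the edge of `F2`, so no image in another
face is needed. -/
theorem consistent_edgeImages : Consistent (1 / 25) edgeImages := by
  intro F G x hF hG
  obtain ⟨h1, ⟨h2, h3⟩, ⟨h4, h5⟩, h6, h7⟩ := mem_face.1 hF
  have h8 := hG.1
  clear hF hG
  cases F <;> cases G <;> simp [edgeImages, neg_eq_iff_eq_neg] at h1 h8 ⊢ <;>
    generalize x 0 = u at * <;> generalize x 1 = v at * <;> generalize x 2 = w at * <;>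
    try (subst h1; first | (exfalso; linarith) | subst h8)
  all_goals
    try refine ⟨?_, ?_⟩
    all_goals
      try intro h
      first
      | linarith
      | nlinarith

/-- The images of `(0, -1/2, 3/10)` for a small disc. -/
noncomputable def edgeImages' : Face → List E3
  | F2 => [!₂[0, -(1 / 2), 3 / 10]]
  | _ => []

theorem consistent_edgeImages' : Consistent (1 / 25) edgeImages' := by
  intro F G x hF hG
  obtain ⟨h1, ⟨h2, h3⟩, ⟨h4, h5⟩, h6, h7⟩ := mem_face.1 hF
  have h8 := hG.1
  clear hF hG
  cases F <;> cases G <;> simp [edgeImages', neg_eq_iff_eq_neg] at h1 h8 ⊢ <;>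
    generalize x 0 = u at * <;> generalize x 1 = v at * <;> generalize x 2 = w at * <;>
    try (subst h1; first | (exfalso; linarith) | subst h8)
  all_goals
    try refine ⟨?_, ?_⟩
    all_goals
      try intro h
      first
      | linarith
      | nlinarith

/-- The images of `(-2/5, 2/5, 1/2)`. -/
noncomputable def cornerImages : Face → List E3
  | F1 => [!₂[-(2 / 5), 2 / 5, 1 / 2]]
  | F3 => [!₂[-(1 / 2), 2 / 5, 3 / 5]]
  | F5 => [!₂[-(2 / 5), 1 / 2, 3 / 5]]
  | _ => []

/-- The point is at distance `1 / 10` from the edges of `F3` and `F5`, so its images there are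
equally far from the points of their common edge; the other two edges, at distance `9 / 10`, are out
of reach. -/
theorem consistent_cornerImages : Consistent (1 / 2) cornerImages := by
  intro F G x hF hG
  obtain ⟨h1, ⟨h2, h3⟩, ⟨h4, h5⟩, h6, h7⟩ := mem_face.1 hF
  have h8 := hG.1
  clear hF hG
  cases F <;> cases G <;> simp [cornerImages, neg_eq_iff_eq_neg] at h1 h8 ⊢ <;>
    generalize x 0 = u at * <;> generalize x 1 = v at * <;> generalize x 2 = w at * <;>
    try (subst h1; first | (exfalso; linarith) | subst h8)
  all_goals
    try refine ⟨?_, ?_⟩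
    all_goals
      try intro h
      first
      | linarith
      | nlinarith

/-- The images of `(-2/5, -1/2, -2/5)`. -/
noncomputable def cornerImages' : Face → List E3
  | F2 => [!₂[-(2 / 5), -(1 / 2), -(2 / 5)]]
  | F3 => [!₂[-(1 / 2), -(3 / 5), -(2 / 5)]]
  | F6 => [!₂[-(2 / 5), -(3 / 5), -(1 / 2)]]
  | _ => []

theorem consistent_cornerImages' : Consistent (1 / 2) cornerImages' := by
  intro F G x hF hG
  obtain ⟨h1, ⟨h2, h3⟩, ⟨h4, h5⟩, h6, h7⟩ := mem_face.1 hF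
  have h8 := hG.1
  clear hF hG
  cases F <;> cases G <;> simp [cornerImages', neg_eq_iff_eq_neg] at h1 h8 ⊢ <;>
    generalize x 0 = u at * <;> generalize x 1 = v at * <;> generalize x 2 = w at * <;>
    try (subst h1; first | (exfalso; linarith) | subst h8)
  all_goals
    try refine ⟨?_, ?_⟩
    all_goals
      try intro h
      first
      | linarith
      | nlinarith

/-- The images of `(0, -3/10, 1/2)`. -/
noncomputable def straightImages : Face → List E3
  | F1 => [!₂[0, -(3 / 10), 1 / 2]]
  | F2 => [!₂[0, -(1 / 2), 7 / 10]]
  | F3 => [!₂[-(1 / 2), -(3 / 10), 1], !₂[-(1 / 2), -1, 7 / 10]]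
  | F4 => [!₂[1 / 2, -(3 / 10), 1], !₂[1 / 2, -1, 7 / 10]]
  | _ => []

/-- `F3` and `F4` see the disc twice, directly from `F1` and across `F2`. The edges of `F5` and `F6`
are farther away than the radius `7 / 10`. -/
theorem consistent_straightImages : Consistent (49 / 100) straightImages := by
  intro F G x hF hG
  obtain ⟨h1, ⟨h2, h3⟩, ⟨h4, h5⟩, h6, h7⟩ := mem_face.1 hF
  have h8 := hG.1
  clear hF hG
  cases F <;> cases G <;> simp [straightImages, neg_eq_iff_eq_neg] at h1 h8 ⊢ <;>
    generalize x 0 = u at * <;> generalize x 1 = v at * <;> generalize x 2 = w at * <;>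
    try (subst h1; first | (exfalso; linarith) | subst h8)
  all_goals
    try refine ⟨?_, ?_⟩
    all_goals
      try intro h
      first
      | linarith
      | (left; linarith)
      | (right; linarith)
      | nlinarith

/-- The images of `(0, -3/10, -1/2)`. -/
noncomputable def straightImages' : Face → List E3
  | F6 => [!₂[0, -(3 / 10), -(1 / 2)]]
  | F2 => [!₂[0, -(1 / 2), -(7 / 10)]]
  | F3 => [!₂[-(1 / 2), -(3 / 10), -1], !₂[-(1 / 2), -1, -(7 / 10)]]
  | F4 => [!₂[1 / 2, -(3 / 10), -1], !₂[1 / 2, -1, -(7 / 10)]]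
  | _ => []

theorem consistent_straightImages' : Consistent (49 / 100) straightImages' := by
  intro F G x hF hG
  obtain ⟨h1, ⟨h2, h3⟩, ⟨h4, h5⟩, h6, h7⟩ := mem_face.1 hF
  have h8 := hG.1
  clear hF hG
  cases F <;> cases G <;> simp [straightImages', neg_eq_iff_eq_neg] at h1 h8 ⊢ <;>
    generalize x 0 = u at * <;> generalize x 1 = v at * <;> generalize x 2 = w at * <;>
    try (subst h1; first | (exfalso; linarith) | subst h8)
  all_goals
    try refine ⟨?_, ?_⟩
    all_goals
      try intro h
      first
      | linarith
      | (left; linarith)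
      | (right; linarith)
      | nlinarith

/-- The images of `(0, -2/5, 1/2)`. -/
noncomputable def zigzagImages : Face → List E3
  | F1 => [!₂[0, -(2 / 5), 1 / 2]]
  | F2 => [!₂[0, -(1 / 2), 3 / 5]]
  | F3 => [!₂[-(1 / 2), -(2 / 5), 1], !₂[-(1 / 2), -1, 3 / 5]]
  | F4 => [!₂[1 / 2, -(2 / 5), 1], !₂[1 / 2, -1, 3 / 5]]
  | _ => []

theorem consistent_zigzagImages : Consistent (61 / 100) zigzagImages := by
  intro F G x hF hG
  obtain ⟨h1, ⟨h2, h3⟩, ⟨h4, h5⟩, h6, h7⟩ := mem_face.1 hF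
  have h8 := hG.1
  clear hF hG
  cases F <;> cases G <;> simp [zigzagImages, neg_eq_iff_eq_neg] at h1 h8 ⊢ <;>
    generalize x 0 = u at * <;> generalize x 1 = v at * <;> generalize x 2 = w at * <;>
    try (subst h1; first | (exfalso; linarith) | subst h8)
  all_goals
    try refine ⟨?_, ?_⟩
    all_goals
      try intro h
      first
      | linarith
      | (left; linarith)
      | (right; linarith)
      | nlinarith

/-- The images of `(-2/5, 0, -1/2)`. -/
noncomputable def zigzagImages' : Face → List E3
  | F6 => [!₂[-(2 / 5), 0, -(1 / 2)]]
  | F3 => [!₂[-(1 / 2), 0, -(3 / 5)]]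
  | F2 => [!₂[-(2 / 5), -(1 / 2), -1], !₂[-1, -(1 / 2), -(3 / 5)]]
  | F5 => [!₂[-(2 / 5), 1 / 2, -1], !₂[-1, 1 / 2, -(3 / 5)]]
  | _ => []

theorem consistent_zigzagImages' : Consistent (61 / 100) zigzagImages' := by
  intro F G x hF hG
  obtain ⟨h1, ⟨h2, h3⟩, ⟨h4, h5⟩, h6, h7⟩ := mem_face.1 hF
  have h8 := hG.1
  clear hF hG
  cases F <;> cases G <;> simp [zigzagImages', neg_eq_iff_eq_neg] at h1 h8 ⊢ <;>
    generalize x 0 = u at * <;> generalize x 1 = v at * <;> generalize x 2 = w at * <;>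
    try (subst h1; first | (exfalso; linarith) | subst h8)
  all_goals
    try refine ⟨?_, ?_⟩
    all_goals
      try intro h
      first
      | linarith
      | (left; linarith)
      | (right; linarith)
      | nlinarith


/-! ### Witnesses for a frame of faces -/

/-- The point of the face `F` with displacement `s` towards `H` and `t` towards `G` from the
centre. -/
noncomputable def framePt (F G H : Face) (s t : ℝ) : E3 :=
  (1 / 2 : ℝ) • normal F + s • normal H + t • normal G

theorem Symmetry.motion_framePt (T : Symmetry) (F G H : Face) (s t : ℝ) :
    T.motion (framePt F G H s t) = framePt (T.perm F) (T.perm G) (T.perm H) s t := by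
  simp only [framePt, map_add, map_smul, T.map_normal]

theorem mem_face_of_mem_faceInterior {F : Face} {x : E3} (h : x ∈ faceInterior F) : x ∈ face F :=
  ⟨h.1, fun G => by
    rcases eq_or_ne G F with rfl | hG
    · exact h.1.le
    · exact (h.2 G hG).le⟩

theorem isLandscape_edge : IsLandscape [F1, F2] :=
  isLandscape_of_infix_path (by decide) (by decide)

theorem isLandscape_zigzag : IsLandscape [F1, F2, F3, F6] :=
  isLandscape_of_infix_path (by decide) (by decide)

theorem isLandscape_corner : IsLandscape [F1, F3, F2] := by
  obtain ⟨T, hT⟩ := exists_symmetry (F := F1) (G := F3) (H := F5) (by decide) (by decide)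
    (by decide)
  have := T.isLandscape_map (isLandscape_of_infix_path (L := [F1, F2, F3]) (by decide) (by decide))
  simpa [hT, frameMap, opp] using this

theorem isLandscape_straight : IsLandscape [F1, F2, F6] := by
  obtain ⟨T, hT⟩ := exists_symmetry (F := F2) (G := F6) (H := F3) (by decide) (by decide)
    (by decide)
  have := T.isLandscape_map (isLandscape_of_infix_path (L := [F5, F1, F2]) (by decide) (by decide))
  simpa [hT, frameMap, opp] using this

theorem segment_subset_region {L : List Face} (hL : L.IsChain Adjacent) (hf : L.head? = some F1)
    {a b : E3} (h : ∀ τ : ℝ, 0 ≤ τ → τ ≤ 1 → a 2 + τ * (b 2 - a 2) = 1 / 2 ∧ ∃ k < L.length,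
      |a 0 + τ * (b 0 - a 0) - (roll F4 F5 L k).cx| ≤ 1 / 2 ∧
      |a 1 + τ * (b 1 - a 1) - (roll F4 F5 L k).cy| ≤ 1 / 2) : segment ℝ a b ⊆ region L := by
  rw [segment_eq_image_lineMap]
  rintro _ ⟨τ, ⟨h0, h1⟩, rfl⟩
  obtain ⟨h2, k, hk, hx, hy⟩ := h τ h0 h1
  rw [mem_region_iff]
  refine ⟨k, hk, (mem_tile_iff hL (f := F1) (r := F4) (t := F5) (by decide) hf hk).2 ?_⟩
  have hc : ∀ i, AffineMap.lineMap a b τ i = a i + τ * (b i - a i) := fun i => by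
    simp [AffineMap.lineMap_apply]; ring
  rw [inner_F1, inner_F4, inner_F5, hc, hc, hc]
  exact ⟨h2, hx, hy⟩

/-- In the applications `R` is the square of half the trail length, so that the two discs just
touch; with squares all data are rational. -/
theorem witnesses_of_discs {F G : Face} {L : List Face} (hL : IsLandscape L)
    (hF : L.head? = some F) (hG : L.getLast? = some G) {p q b : E3} (hp : p ∈ faceInterior F)
    (hq : q ∈ faceInterior G) (hb : develop L (L.length - 1) q = b)
    (hseg : segment ℝ p b ⊆ region L) {R : ℝ} (hR : 0 ≤ R) {A B : Face → List E3}
    (hA : Consistent R A) (hB : Consistent R B) (hAB : ∀ F, ∀ a ∈ A F, ∀ b ∈ B F,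
      4 * R ≤ (a 0 - b 0) ^ 2 + (a 1 - b 1) ^ 2 + (a 2 - b 2) ^ 2)
    (hpA : p ∈ A F) (hqB : q ∈ B G)
    (hd : (p 0 - b 0) ^ 2 + (p 1 - b 1) ^ 2 + (p 2 - b 2) ^ 2 ≤ 4 * R) : Witnesses L p q := by
  have hpF := mem_face_of_mem_faceInterior hp
  have hqF := mem_face_of_mem_faceInterior hq
  refine witnesses_of_interior hL hF hG hp hpF hq hqF ?_ ?_ <;> rw [hb]
  · exact hseg
  · exact edist_le_surfaceDist_of_discs hR hA hB hAB hpF hqF hpA hqB hd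

theorem witnesses_edge_base :
    Witnesses [F1, F2] (framePt F1 F2 F4 0 (3 / 10)) (framePt F2 F1 F4 0 (3 / 10)) := by
  have hp : framePt F1 F2 F4 0 (3 / 10) = !₂[0, -(3 / 10), 1 / 2] := by
    refine ext_coord ?_ ?_ ?_ <;> simp [framePt, normalZ]
  have hq : framePt F2 F1 F4 0 (3 / 10) = !₂[0, -(1 / 2), 3 / 10] := by
    refine ext_coord ?_ ?_ ?_ <;> simp [framePt, normalZ]
  rw [hp, hq]
  refine witnesses_of_discs (b := !₂[0, -(7 / 10), 1 / 2]) isLandscape_edge rfl rfl ?_ ?_ ?_ ?_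
    (by norm_num) consistent_edgeImages consistent_edgeImages' (fun F => ?_)
    (by simp [edgeImages]) (by simp [edgeImages']) ?_
  · rw [mem_faceInterior]; simp; norm_num
  · rw [mem_faceInterior]; simp; norm_num
  · refine ext_coord ?_ ?_ ?_ <;> simp [hinge, normalZ] <;> norm_num
  · refine segment_subset_region (by decide) rfl fun τ h0 h1 => ⟨by simp, ?_⟩
    rcases le_total τ (1 / 2) with h2 | h2
    · refine ⟨0, by decide, ?_⟩
      simp [roll, abs_le]
      norm_num
      constructor <;> linarith
    refine ⟨1, by decide, ?_⟩
    simp [roll, Placement.shift, opp, abs_le]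
    norm_num
    constructor <;> linarith
  · cases F <;> simp [edgeImages, edgeImages']
  · simp; norm_num

theorem witnesses_corner_base :
    Witnesses [F1, F3, F2] (framePt F1 F2 F4 (-(2 / 5)) (-(2 / 5)))
      (framePt F2 F1 F4 (-(2 / 5)) (-(2 / 5))) := by
  have hp : framePt F1 F2 F4 (-(2 / 5)) (-(2 / 5)) = !₂[-(2 / 5), 2 / 5, 1 / 2] := by
    refine ext_coord ?_ ?_ ?_ <;> simp [framePt, normalZ]
  have hq : framePt F2 F1 F4 (-(2 / 5)) (-(2 / 5)) = !₂[-(2 / 5), -(1 / 2), -(2 / 5)] := by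
    refine ext_coord ?_ ?_ ?_ <;> simp [framePt, normalZ]
  rw [hp, hq]
  refine witnesses_of_discs (b := !₂[-(7 / 5), -(3 / 5), 1 / 2]) isLandscape_corner rfl rfl ?_ ?_
    ?_ ?_ (by norm_num) consistent_cornerImages consistent_cornerImages' (fun F => ?_)
    (by simp [cornerImages]) (by simp [cornerImages']) ?_
  · rw [mem_faceInterior]; simp; norm_num
  · rw [mem_faceInterior]; simp; norm_num
  · refine ext_coord ?_ ?_ ?_ <;> simp [hinge, normalZ] <;> norm_num
  · refine segment_subset_region (by decide) rfl fun τ h0 h1 => ⟨by simp, ?_⟩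
    rcases le_total τ (1 / 10) with h2 | h2
    · refine ⟨0, by decide, ?_⟩
      simp [roll, abs_le]
      norm_num
      refine ⟨⟨?_, ?_⟩, ?_, ?_⟩ <;> linarith
    rcases le_total τ (9 / 10) with h3 | h3
    · refine ⟨1, by decide, ?_⟩
      simp [roll, Placement.shift, opp, abs_le]
      norm_num
      refine ⟨⟨?_, ?_⟩, ?_, ?_⟩ <;> linarith
    refine ⟨2, by decide, ?_⟩
    simp [roll, Placement.shift, opp, abs_le]
    norm_num
    refine ⟨⟨?_, ?_⟩, ?_, ?_⟩ <;> linarith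
  · cases F <;> simp [cornerImages, cornerImages']
    norm_num
  · simp; norm_num

theorem witnesses_straight_base :
    Witnesses [F1, F2, F6] (framePt F1 F2 F4 0 (3 / 10)) (framePt F6 F2 F4 0 (3 / 10)) := by
  have hp : framePt F1 F2 F4 0 (3 / 10) = !₂[0, -(3 / 10), 1 / 2] := by
    refine ext_coord ?_ ?_ ?_ <;> simp [framePt, normalZ]
  have hq : framePt F6 F2 F4 0 (3 / 10) = !₂[0, -(3 / 10), -(1 / 2)] := by
    refine ext_coord ?_ ?_ ?_ <;> simp [framePt, normalZ]
  rw [hp, hq]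
  refine witnesses_of_discs (b := !₂[0, -(17 / 10), 1 / 2]) isLandscape_straight rfl rfl ?_ ?_
    ?_ ?_ (by norm_num) consistent_straightImages consistent_straightImages' (fun F => ?_)
    (by simp [straightImages]) (by simp [straightImages']) ?_
  · rw [mem_faceInterior]; simp; norm_num
  · rw [mem_faceInterior]; simp; norm_num
  · refine ext_coord ?_ ?_ ?_ <;> simp [hinge, normalZ] <;> norm_num
  · refine segment_subset_region (by decide) rfl fun τ h0 h1 => ⟨by simp, ?_⟩
    rcases le_total τ (1 / 7) with h2 | h2
    · refine ⟨0, by decide, ?_⟩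
      simp [roll, abs_le]
      norm_num
      constructor <;> linarith
    rcases le_total τ (6 / 7) with h3 | h3
    · refine ⟨1, by decide, ?_⟩
      simp [roll, Placement.shift, opp, abs_le]
      norm_num
      constructor <;> linarith
    refine ⟨2, by decide, ?_⟩
    simp [roll, Placement.shift, opp, abs_le]
    norm_num
    constructor <;> linarith
  · cases F <;> simp [straightImages, straightImages'] <;> norm_num
  · simp; norm_num

theorem witnesses_zigzag_base :
    Witnesses [F1, F2, F3, F6] (framePt F1 F2 F4 0 (2 / 5)) (framePt F6 F2 F4 (-(2 / 5)) 0) := by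
  have hp : framePt F1 F2 F4 0 (2 / 5) = !₂[0, -(2 / 5), 1 / 2] := by
    refine ext_coord ?_ ?_ ?_ <;> simp [framePt, normalZ]
  have hq : framePt F6 F2 F4 (-(2 / 5)) 0 = !₂[-(2 / 5), 0, -(1 / 2)] := by
    refine ext_coord ?_ ?_ ?_ <;> simp [framePt, normalZ]
  rw [hp, hq]
  refine witnesses_of_discs (b := !₂[-1, -(8 / 5), 1 / 2]) isLandscape_zigzag rfl rfl ?_ ?_ ?_ ?_
    (by norm_num) consistent_zigzagImages consistent_zigzagImages' (fun F => ?_)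
    (by simp [zigzagImages]) (by simp [zigzagImages']) ?_
  · rw [mem_faceInterior]; simp; norm_num
  · rw [mem_faceInterior]; simp; norm_num
  · refine ext_coord ?_ ?_ ?_ <;> simp [hinge, normalZ] <;> norm_num
  · refine segment_subset_region (by decide) rfl fun τ h0 h1 => ⟨by simp, ?_⟩
    -- The segment from `(0, -2/5)` to `(-1, -8/5)` crosses the three common edges at the times `1 /
    -- 12`, `1 / 2`, `11 / 12`.
    rcases le_total τ (1 / 12) with h2 | h2
    · refine ⟨0, by decide, ?_⟩
      simp [roll, abs_le]
      norm_num
      refine ⟨⟨?_, ?_⟩, ?_, ?_⟩ <;> linarith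
    rcases le_total τ (1 / 2) with h3 | h3
    · refine ⟨1, by decide, ?_⟩
      simp [roll, Placement.shift, opp, abs_le]
      norm_num
      refine ⟨⟨?_, ?_⟩, ?_, ?_⟩ <;> linarith
    rcases le_total τ (11 / 12) with h4 | h4
    · refine ⟨2, by decide, ?_⟩
      simp [roll, Placement.shift, opp, abs_le]
      norm_num
      refine ⟨⟨?_, ?_⟩, ?_, ?_⟩ <;> linarith
    refine ⟨3, by decide, ?_⟩
    simp [roll, Placement.shift, opp, abs_le]
    norm_num
    refine ⟨⟨?_, ?_⟩, ?_, ?_⟩ <;> linarith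
  · cases F <;> simp [zigzagImages, zigzagImages'] <;> norm_num
  · simp; norm_num

section frames

variable {F G H : Face}

theorem witnesses_edge (h : IsFrame F G H) :
    Witnesses [F, G] (framePt F G H 0 (3 / 10)) (framePt G F H 0 (3 / 10)) := by
  obtain ⟨T, hT⟩ := exists_symmetry h.1 h.2.1 h.2.2
  simpa [T.motion_framePt, hT, frameMap] using T.witnesses_map witnesses_edge_base

theorem witnesses_corner (h : IsFrame F G H) :
    Witnesses [F, opp H, G] (framePt F G H (-(2 / 5)) (-(2 / 5)))
      (framePt G F H (-(2 / 5)) (-(2 / 5))) := by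
  obtain ⟨T, hT⟩ := exists_symmetry h.1 h.2.1 h.2.2
  simpa [T.motion_framePt, hT, frameMap] using T.witnesses_map witnesses_corner_base

theorem witnesses_straight (h : IsFrame F G H) :
    Witnesses [F, G, opp F] (framePt F G H 0 (3 / 10)) (framePt (opp F) G H 0 (3 / 10)) := by
  obtain ⟨T, hT⟩ := exists_symmetry h.1 h.2.1 h.2.2
  simpa [T.motion_framePt, hT, frameMap] using T.witnesses_map witnesses_straight_base

theorem witnesses_zigzag (h : IsFrame F G H) :
    Witnesses [F, G, opp H, opp F] (framePt F G H 0 (2 / 5))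
      (framePt (opp F) G H (-(2 / 5)) 0) := by
  obtain ⟨T, hT⟩ := exists_symmetry h.1 h.2.1 h.2.2
  simpa [T.motion_framePt, hT, frameMap] using T.witnesses_map witnesses_zigzag_base

end frames


/-! ### Labellings -/

/-- The face which comes after `G` counter-clockwise around `F`. -/
def ccw : Face → Face → Face
  | F1, F2 => F4 | F1, F4 => F5 | F1, F5 => F3 | F1, F3 => F2
  | F6, F2 => F3 | F6, F3 => F5 | F6, F5 => F4 | F6, F4 => F2
  | F2, F1 => F3 | F2, F3 => F6 | F2, F6 => F4 | F2, F4 => F1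
  | F5, F1 => F4 | F5, F4 => F6 | F5, F6 => F3 | F5, F3 => F1
  | F3, F1 => F5 | F3, F5 => F6 | F3, F6 => F2 | F3, F2 => F1
  | F4, F1 => F2 | F4, F2 => F6 | F4, F6 => F5 | F4, F5 => F1
  | F, _ => F

theorem ccwNext_iff (F G H : Face) : CcwNext F G H ↔ Adjacent F G ∧ H = ccw F G := by
  revert F G H; decide +kernel

theorem normalZ_ccw {F G : Face} (h : Adjacent F G) :
    normalZ (ccw F G) = crossProduct (normalZ F) (normalZ G) :=
  ((ccwNext_iff F G _).2 ⟨h, rfl⟩).2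

theorem isFrame_ccw {F G : Face} (h : Adjacent F G) : IsFrame F G (ccw F G) := by
  have key : ∀ F G : Face, Adjacent F G → IsFrame F G (ccw F G) := by decide
  exact key F G h

/-- `pt` depends on the orientation, `framePt` does not: `H` may be the counter-clockwise or the
clockwise neighbour, which decides the sign of `s`. -/
theorem pt_eq_framePt {F G H : Face} (h : Adjacent F G) {x y s t : ℝ}
    (hs : ccw F G = H ∧ s = x - 1 / 2 ∨ ccw F G = opp H ∧ s = 1 / 2 - x) (ht : t = 1 / 2 - y) :
    pt F G x y = framePt F G H s t := by
  have : pt F G x y = framePt F G (ccw F G) (x - 1 / 2) (1 / 2 - y) := by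
    simp only [pt, framePt, normal, normalZ_ccw h]
  rw [this, ht]
  rcases hs with ⟨rfl, rfl⟩ | ⟨h, rfl⟩
  · rfl
  · rw [h, framePt, framePt, normal_opp]
    module

/-- The labelling which sends `F1` and `F2` to `F` and `G`. -/
def label (F G : Face) : Face → Face := frameMap F G (ccw F G)

/-- The images of `F1` and `F2` determine the rest: the counter-clockwise order gives the other
neighbours, and `n F6` is opposite to `n F1`. -/
theorem IsLabelling.exists_eq_label {n : Equiv.Perm Face} (h : IsLabelling n) :
    ∃ F G, Adjacent F G ∧ ∀ X, n X = label F G X := by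
  obtain ⟨h6, hccw⟩ := h
  have hn : ∀ G H, CcwNext F1 G H → n H = ccw (n F1) (n G) ∧ Adjacent (n F1) (n G) :=
    fun G H h => ((ccwNext_iff _ _ _).1 (hccw G H h)).symm
  have h4 := hn F2 F4 (by decide)
  have h5 := hn F4 F5 (by decide)
  have h3 := hn F5 F3 (by decide)
  have key : ∀ F G : Face, Adjacent F G → ccw F (ccw F G) = opp G ∧ ccw F (opp G) = opp (ccw F G) ∧
    ∀ H, IsOpposite F H → H = opp F := by decide
  obtain ⟨k1, k2, k3⟩ := key _ _ h4.2
  refine ⟨n F1, n F2, h4.2, forall_face.2 ⟨rfl, rfl, ?_, h4.1, ?_, k3 _ h6⟩⟩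
  · rw [h3.1, h5.1, h4.1, k1, k2]; rfl
  · rw [h5.1, h4.1, k1]; rfl

theorem exists_symmetry_label {F G : Face} (h : Adjacent F G) :
    ∃ T : Symmetry, IsLabelling T.perm ∧ ∀ X, T.perm X = label F G X := by
  obtain ⟨h1, h2, h3⟩ := isFrame_ccw h
  obtain ⟨T, hT⟩ := exists_symmetry h1 h2 h3
  have key : ∀ F G : Face, Adjacent F G → IsOpposite (label F G F1) (label F G F6) ∧
    ∀ X, Adjacent F1 X → Adjacent (label F G F1) (label F G X) ∧
      label F G (ccw F1 X) = ccw (label F G F1) (label F G X) := by decide +kernel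
  obtain ⟨k1, k2⟩ := key F G h
  refine ⟨T, ⟨?_, fun X Y hXY => ?_⟩, hT⟩
  · rw [hT, hT]; exact k1
  · rw [ccwNext_iff] at hXY
    rw [ccwNext_iff, hXY.2, hT, hT, hT]
    exact k2 X hXY.1

/-- `landscape` for a map which need not be a permutation. -/
def landscapeOf (f : Face → Face) : Fin 15 → List Face :=
  ![[f F1, f F2], [f F1, f F3, f F2], [f F1, f F4, f F2],
    [f F1, f F2, f F6], [f F1, f F3, f F6], [f F1, f F4, f F6], [f F1, f F5, f F6],
    [f F1, f F2, f F3, f F6], [f F1, f F3, f F5, f F6],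
    [f F1, f F5, f F4, f F6], [f F1, f F4, f F2, f F6],
    [f F1, f F2, f F4, f F6], [f F1, f F3, f F2, f F6],
    [f F1, f F5, f F3, f F6], [f F1, f F4, f F5, f F6]]

/-- With `f = label F G`, finite checks range over pairs of faces instead of permutations. -/
theorem landscape_eq {n : Equiv.Perm Face} {f : Face → Face} (h : ∀ X, n X = f X) :
    landscape n = landscapeOf f := by
  obtain rfl : ⇑n = f := funext h
  rfl

theorem forall_fin_fifteen {p : Fin 15 → Prop} (h0 : p 0) (h1 : p 1) (h2 : p 2) (h3 : p 3)
    (h4 : p 4) (h5 : p 5) (h6 : p 6) (h7 : p 7) (h8 : p 8) (h9 : p 9) (h10 : p 10) (h11 : p 11)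
    (h12 : p 12) (h13 : p 13) (h14 : p 14) : ∀ i, p i := by
  intro i; fin_cases i <;> assumption

theorem witnesses_of_pt {L : List Face} {F G H F' G' H' : Face} {s t s' t' x y x' y' : ℝ}
    (h : Witnesses L (framePt F G H s t) (framePt F' G' H' s' t')) (hF : Adjacent F G)
    (hF' : Adjacent F' G')
    (hs : ccw F G = H ∧ s = x - 1 / 2 ∨ ccw F G = opp H ∧ s = 1 / 2 - x)
    (ht : t = 1 / 2 - y)
    (hs' : ccw F' G' = H' ∧ s' = x' - 1 / 2 ∨ ccw F' G' = opp H' ∧ s' = 1 / 2 - x')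
    (ht' : t' = 1 / 2 - y') : Witnesses L (pt F G x y) (pt F' G' x' y') := by
  rwa [pt_eq_framePt hF hs ht, pt_eq_framePt hF' hs' ht']

/-- Each of the fifteen is one of the four shapes; mirror images, such as the last four zigzags,
come from frames of the other orientation. -/
theorem witnesses_landscape_refl : ∀ i : Fin 15, Witnesses (landscape (Equiv.refl Face) i)
    (witness (Equiv.refl Face) i).1 (witness (Equiv.refl Face) i).2 := by
  refine forall_fin_fifteen
    (witnesses_of_pt (witnesses_edge (F := F1) (G := F2) (H := F4) (by decide)) ?_ ?_ ?_ ?_ ?_ ?_)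
    (witnesses_of_pt (witnesses_corner (F := F1) (G := F2) (H := F4) (by decide)) ?_ ?_ ?_ ?_ ?_ ?_)
    (witnesses_of_pt (witnesses_corner (F := F1) (G := F2) (H := F3) (by decide)) ?_ ?_ ?_ ?_ ?_ ?_)
    (witnesses_of_pt (witnesses_straight (F := F1) (G := F2) (H := F4) (by decide)) ?_ ?_ ?_ ?_ ?_ ?_)
    (witnesses_of_pt (witnesses_straight (F := F1) (G := F3) (H := F2) (by decide)) ?_ ?_ ?_ ?_ ?_ ?_)
    (witnesses_of_pt (witnesses_straight (F := F1) (G := F4) (H := F5) (by decide)) ?_ ?_ ?_ ?_ ?_ ?_)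
    (witnesses_of_pt (witnesses_straight (F := F1) (G := F5) (H := F3) (by decide)) ?_ ?_ ?_ ?_ ?_ ?_)
    (witnesses_of_pt (witnesses_zigzag (F := F1) (G := F2) (H := F4) (by decide)) ?_ ?_ ?_ ?_ ?_ ?_)
    (witnesses_of_pt (witnesses_zigzag (F := F1) (G := F3) (H := F2) (by decide)) ?_ ?_ ?_ ?_ ?_ ?_)
    (witnesses_of_pt (witnesses_zigzag (F := F1) (G := F5) (H := F3) (by decide)) ?_ ?_ ?_ ?_ ?_ ?_)
    (witnesses_of_pt (witnesses_zigzag (F := F1) (G := F4) (H := F5) (by decide)) ?_ ?_ ?_ ?_ ?_ ?_)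
    (witnesses_of_pt (witnesses_zigzag (F := F1) (G := F2) (H := F3) (by decide)) ?_ ?_ ?_ ?_ ?_ ?_)
    (witnesses_of_pt (witnesses_zigzag (F := F1) (G := F3) (H := F5) (by decide)) ?_ ?_ ?_ ?_ ?_ ?_)
    (witnesses_of_pt (witnesses_zigzag (F := F1) (G := F5) (H := F4) (by decide)) ?_ ?_ ?_ ?_ ?_ ?_)
    (witnesses_of_pt (witnesses_zigzag (F := F1) (G := F4) (H := F2) (by decide)) ?_ ?_ ?_ ?_ ?_ ?_)
  all_goals first
    | decide
    | (norm_num; done)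
    | exact Or.inl ⟨by decide, by norm_num⟩
    | exact Or.inr ⟨by decide, by norm_num⟩

/-- The validity of the fifteen landscapes of a labelling is witnessed by the given points. -/
theorem IsLabelling.witnesses {n : Equiv.Perm Face} (h : IsLabelling n) (i : Fin 15) :
    Witnesses (landscape n i) (witness n i).1 (witness n i).2 := by
  obtain ⟨F, G, hFG, hn⟩ := h.exists_eq_label
  obtain ⟨T, -, hT⟩ := exists_symmetry_label hFG
  obtain rfl : n = T.perm := Equiv.ext fun X => (hn X).trans (hT X).symm
  -- A labelling preserves the counter-clockwise order around every face, not only around `F1`, so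
  -- its motion carries `pt` to `pt`.
  have key : ∀ F G : Face, Adjacent F G → ∀ X Y, Adjacent X Y →
      label F G (ccw X Y) = ccw (label F G X) (label F G Y) := by decide +kernel
  have hpt : ∀ X Y, Adjacent X Y → ∀ x y,
      T.motion (pt X Y x y) = pt (T.perm X) (T.perm Y) x y := by
    intro X Y hXY x y
    rw [pt_eq_framePt hXY (Or.inl ⟨rfl, rfl⟩) rfl,
      pt_eq_framePt (T.adjacent_iff.2 hXY) (Or.inl ⟨rfl, rfl⟩) rfl, T.motion_framePt, hT, hT, hT,
      key F G hFG X Y hXY]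
  have hw : ∀ i, witness T.perm i = (T.motion (witness (Equiv.refl Face) i).1,
      T.motion (witness (Equiv.refl Face) i).2) := by
    refine forall_fin_fifteen ?_ ?_ ?_ ?_ ?_ ?_ ?_ ?_ ?_ ?_ ?_ ?_ ?_ ?_ ?_ <;>
      exact (Prod.ext (hpt _ _ (by decide) _ _) (hpt _ _ (by decide) _ _)).symm
  have hl : ∀ i, landscape T.perm i = (landscape (Equiv.refl Face) i).map T.perm := by
    refine forall_fin_fifteen ?_ ?_ ?_ ?_ ?_ ?_ ?_ ?_ ?_ ?_ ?_ ?_ ?_ ?_ ?_ <;> rfl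
  rw [hw, hl]
  exact T.witnesses_map (witnesses_landscape_refl i)

theorem isLandscape_of_isFrame {F G H : Face} (h : IsFrame F G H) : IsLandscape [F, G] ∧
    IsLandscape [F, opp H, G] ∧ IsLandscape [F, G, opp F] ∧ IsLandscape [F, G, opp H, opp F] := by
  obtain ⟨T, hT⟩ := exists_symmetry h.1 h.2.1 h.2.2
  refine ⟨?_, ?_, ?_, ?_⟩
  · simpa [hT, frameMap] using T.isLandscape_map isLandscape_edge
  · simpa [hT, frameMap] using T.isLandscape_map isLandscape_corner
  · simpa [hT, frameMap] using T.isLandscape_map isLandscape_straight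
  · simpa [hT, frameMap] using T.isLandscape_map isLandscape_zigzag

theorem isLandscape_landscapeOf_label {F G : Face} (h : Adjacent F G) (i : Fin 15) :
    IsLandscape (landscapeOf (label F G) i) := by
  have key : ∀ F G : Face, Adjacent F G → ∀ i, ∃ G' H', IsFrame F G' H' ∧
      landscapeOf (label F G) i ∈
        [[F, G'], [F, opp H', G'], [F, G', opp F], [F, G', opp H', opp F]] := by decide +kernel
  obtain ⟨G', H', hf, hL⟩ := key F G h i
  obtain ⟨h1, h2, h3, h4⟩ := isLandscape_of_isFrame hf
  simp only [List.mem_cons, List.not_mem_nil, or_false] at hL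
  rcases hL with hL | hL | hL | hL <;> rw [hL] <;> assumption

theorem IsLabelling.isValidLandscape {n : Equiv.Perm Face} (h : IsLabelling n) (i : Fin 15) :
    IsValidLandscape (landscape n i) := by
  obtain ⟨F, G, hFG, hn⟩ := h.exists_eq_label
  exact ⟨by rw [landscape_eq hn]; exact isLandscape_landscapeOf_label hFG i, _, _, h.witnesses i⟩

theorem exists_landscape_of_isValidLandscape {L : List Face} (h : IsValidLandscape L) :
    ∃ n : Equiv.Perm Face, IsLabelling n ∧ ∃ i, L = landscape n i := by
  obtain ⟨T, L, rfl, -, h2, h3, h4⟩ := h.1.isFacePath.exists_map_eq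
  rw [T.isValidLandscape_map_iff] at h
  have hf : IsFrame (T.perm F1) (T.perm F2) (T.perm F4) :=
    ⟨T.adjacent_iff.2 (by decide), T.adjacent_iff.2 (by decide), T.adjacent_iff.2 (by decide)⟩
  have h6 : T.perm F6 = opp (T.perm F1) := by
    have key : ∀ F G : Face, dotProduct (normalZ F) (normalZ G) = -1 → G = opp F := by decide
    exact key _ _ (by rw [T.dotProduct_perm]; decide)
  -- The symmetry `T` may reverse the orientation and then gives no labelling; a labelling with the
  -- same first face is found afresh.
  have key : ∀ F G H : Face, IsFrame F G H → ∀ L ∈ [[F, G], [F, G, H], [F, G, opp F],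
      [F, G, H, opp F]], ∃ F' G' : Face, Adjacent F' G' ∧ F' = F ∧
        ∃ i, L = landscapeOf (label F' G') i := by decide +kernel
  obtain ⟨F', G', hadj, -, i, hi⟩ := key _ _ _ hf (L.map T.perm) (by
    rcases eq_of_isValidLandscape_of_normal h h2 h3 h4 with rfl | rfl | rfl | rfl <;> simp [h6])
  obtain ⟨S, hS, hS'⟩ := exists_symmetry_label hadj
  exact ⟨S.perm, hS, i, by rw [hi, landscape_eq hS']⟩

theorem IsLabelling.injective_landscape {n : Equiv.Perm Face} (h : IsLabelling n) :
    Function.Injective (landscape n) := by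
  obtain ⟨F, G, hFG, hn⟩ := h.exists_eq_label
  have key : ∀ F G : Face, Adjacent F G → ∀ i j,
      landscapeOf (label F G) i = landscapeOf (label F G) j → i = j := by decide +kernel
  rw [landscape_eq hn]
  exact fun i j => key F G hFG i j

/-- The landscapes of a labelling `n` have the origin `n F1`; the first three have the
destination `n F2`, the others the destination `n F6`. -/
theorem IsLabelling.isLandscapeFromTo {n : Equiv.Perm Face} (h : IsLabelling n) (i : Fin 15) :
    IsLandscapeFromTo (landscape n i) (n F1) (if i.val < 3 then n F2 else n F6) := by
  refine ⟨(h.isValidLandscape i).1, ?_⟩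
  revert i
  refine forall_fin_fifteen ?_ ?_ ?_ ?_ ?_ ?_ ?_ ?_ ?_ ?_ ?_ ?_ ?_ ?_ ?_ <;> exact ⟨rfl, rfl⟩

/-- The labelling that produces `L` agrees with `n` on `F1`, but perhaps not on `F2`. A finite check
over both second faces rewrites `L` in terms of `n`. -/
theorem exists_landscape_of_isLandscapeFromTo {n : Equiv.Perm Face} (h : IsLabelling n)
    {L : List Face} (hL : IsValidLandscape L) {X : Face} (hX : IsLandscapeFromTo L (n F1) (n X)) :
    (X = F2 → ∃ i : Fin 15, i.val < 3 ∧ L = landscape n i) ∧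
      (X = F6 → ∃ i : Fin 15, 3 ≤ i.val ∧ L = landscape n i) := by
  obtain ⟨m, hm, j, rfl⟩ := exists_landscape_of_isValidLandscape hL
  obtain ⟨F, G, hFG, hn⟩ := h.exists_eq_label
  obtain ⟨F', G', hFG', hm'⟩ := hm.exists_eq_label
  obtain ⟨-, h1, h2⟩ := hX
  rw [landscape_eq hm'] at h1 h2 ⊢
  rw [landscape_eq hn]
  rw [hn] at h1 h2
  have hF : ∀ F G F' G' : Face, ∀ i, (landscapeOf (label F' G') i).head? = some (label F G F1) →
      F' = F := fun F G F' G' => by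
    refine forall_fin_fifteen ?_ ?_ ?_ ?_ ?_ ?_ ?_ ?_ ?_ ?_ ?_ ?_ ?_ ?_ ?_ <;>
      exact fun h => Option.some.inj h
  obtain rfl := hF F G F' G' j h1
  have key2 : ∀ F G G' : Face, Adjacent F G → Adjacent F G' → ∀ j,
      (landscapeOf (label F G') j).getLast? = some (label F G F2) →
      ∃ i : Fin 15, i.val < 3 ∧ landscapeOf (label F G') j = landscapeOf (label F G) i := by
    decide +kernel
  have key6 : ∀ F G G' : Face, Adjacent F G → Adjacent F G' → ∀ j,
      (landscapeOf (label F G') j).getLast? = some (label F G F6) →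
      ∃ i : Fin 15, 3 ≤ i.val ∧ landscapeOf (label F G') j = landscapeOf (label F G) i := by
    decide +kernel
  exact ⟨fun hX => key2 F' G G' hFG hFG' j (hX ▸ h2), fun hX => key6 F' G G' hFG hFG' j (hX ▸ h2)⟩

end CubeLandscape

theorem mainTheorem4 :
    (∀ L : List Face, IsValidLandscape L ↔
      ∃ n : Equiv.Perm Face, IsLabelling n ∧ ∃ i : Fin 15, L = landscape n i) ∧
    (∀ n : Equiv.Perm Face, IsLabelling n →
      Function.Injective (landscape n) ∧
      {L | IsValidLandscape L ∧ IsLandscapeFromTo L (n Face.F1) (n Face.F2)}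
        = {L | ∃ i : Fin 15, i.val < 3 ∧ L = landscape n i} ∧
      {L | IsValidLandscape L ∧ IsLandscapeFromTo L (n Face.F1) (n Face.F6)}
        = {L | ∃ i : Fin 15, 3 ≤ i.val ∧ L = landscape n i} ∧
      ∀ i : Fin 15,
        Witnesses (landscape n i) (witness n i).1 (witness n i).2) := by
  refine ⟨fun L => ⟨exists_landscape_of_isValidLandscape, ?_⟩, fun n h =>
    ⟨h.injective_landscape, Set.ext fun L => ⟨fun hL => ?_, ?_⟩,
      Set.ext fun L => ⟨fun hL => ?_, ?_⟩, h.witnesses⟩⟩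
  · rintro ⟨n, h, i, rfl⟩
    exact h.isValidLandscape i
  · exact (exists_landscape_of_isLandscapeFromTo h hL.1 hL.2).1 rfl
  · rintro ⟨i, hi, rfl⟩
    exact ⟨h.isValidLandscape i, by simpa [hi] using h.isLandscapeFromTo i⟩
  · exact (exists_landscape_of_isLandscapeFromTo h hL.1 hL.2).2 rfl
  · rintro ⟨i, hi, rfl⟩
    exact ⟨h.isValidLandscape i, by simpa [hi.not_gt] using h.isLandscapeFromTo i⟩
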